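/- Conventions. All po-groups are Abelian. A poset is an antilattice if any two of its elements that have an infimum or a supremum are comparable. A strong unit of a po-group $H$ is an element $u\ge 0$ such that every $h\in H$ satisfies $h\le nu$ for some integer $n\ge 0$; then $(H,u)$ is called a unital po-group, and $\Gamma(H,u)=\{h\in H: 0\le h\le u\}$ is the effect algebra with unit $u$ in which $a+b$ is defined iff $a+b\le u$ in $H$, and is then the sum in $H$. A po-group $G$ (an effect algebra $E$) has RDP if, whenever $a_1+a_2=b_1+b_2$ with $a_i,b_j$ in $G^+=\{g\in G: g\ge 0\}$ (in $E$), there are $c_{11},c_{12},c_{21},c_{22}$ in $G^+$ (in $E$) with $a_i=c_{i1}+c_{i2}$ and $b_j=c_{1j}+c_{2j}$ for $i,j=1,2$. $H\times_{\mathrm{lex}}G$ is the group $H\times G$ ordered by $(h_1,g_1)\le(h_2,g_2)$ iff $h_1<h_2$, or $h_1=h_2$ and $g_1\le g_2$. A homomorphism of effect algebras is a map with $h(1)=1$ such that, whenever $a+b$ is defined, $h(a)+h(b)$ is defined and equal to $h(a+b)$; $\cong$ means that there is a bijection that is a homomorphism together with its inverse. In an effect algebra, $a\le b$ means that $a+c=b$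 for some $c$, and then $b-a:=c$. An ideal of an effect algebra $E$ is a nonempty subset $I\subseteq E$ such that $a\le b\in I$ implies $a\in I$, and $a+b\in I$ whenever $a,b\in I$ and $a+b$ is defined. Let $\langle I\rangle$ be the effect subalgebra of $E$ generated by $I$, and $I_0(x)$ the ideal generated by $x\in E$. If $E$ has RDP, $E/I$ is the quotient effect algebra by the congruence $a\sim_I b$ iff $a-e=b-f$ for some $e,f\in I$ with $e\le a$, $f\le b$; write $x/I$ for the class of $x$. An ideal $I$ of an effect algebra $E$ with RDP is lexicographic if $\{0\}\ne I\ne E$ and 1. $I$ is strict: $x/I<y/I$ implies $x<y$; 2. $I$ is retractive: there is a homomorphism $\delta:E/I\to E$ with $\delta(z)/I=z$ for all $z\in E/I$; 3. $I$ is prime: $I_0(x)\cap I_0(y)\subseteq I$ implies $x\in I$ or $y\in I$. **Theorem 6.5.** Let $E$ be an effect algebra with RDP and let $I$ be a lexicographic ideal of $E$. Then there are a nontrivial antilattice unital po-group $(H,u)$ with RDP and a nontrivial directed po-group $G$ with RDP such that $$E/I\cong\Gamma(H,u),\qquad \langle I\rangle\cong\Gamma(\mathbb Z\times_{\mathrm{lex}}G,(1,0)),\qquad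 E\cong\Gamma(H\times_{\mathrm{lex}}G,(u,0)).$$ Conversely, let $(H,u)$ be a nontrivial antilattice unital po-group with RDP, let $G$ be a nontrivial directed po-group with RDP, and let $E$ be an effect algebra with $E\cong\Gamma(H\times_{\mathrm{lex}}G,(u,0))$. Then $E$ has RDP, and $E$ has a lexicographic ideal $I$ such that $E/I\cong\Gamma(H,u)$ and $\langle I\rangle\cong\Gamma(\mathbb Z\times_{\mathrm{lex}}G,(1,0))$. -/

import Mathlib

universe v w₁ w₂ w₃

/-- An effect algebra: a partial algebra `(E; +, 0, 1)`. The partial addition is given by its graph: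
`IsSum a b c` says that `a + b` is defined and equal to `c`. -/
class EffectAlgebra (E : Type*) extends Zero E, One E where
  IsSum : E → E → E → Prop
  isSum_unique : ∀ {a b c d : E}, IsSum a b c → IsSum a b d → c = d
  isSum_comm : ∀ {a b c : E}, IsSum a b c → IsSum b a c
  /-- `(a + b) + c` is defined with value `e` iff `a + (b + c)` is defined with value `e`. -/
  isSum_assoc : ∀ {a b c e : E},
    (∃ d, IsSum a b d ∧ IsSum d c e) ↔ (∃ f, IsSum b c f ∧ IsSum a f e)
  existsUnique_compl : ∀ a : E, ∃! b, IsSum a b 1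
  eq_zero_of_isSum_one : ∀ {a c : E}, IsSum a 1 c → a = 0

namespace EffectAlgebra

section Basic

variable {E : Type*} [EffectAlgebra E]

/-- `a ≤ b` iff `a + c = b` for some `c`. -/
def Le (a b : E) : Prop := ∃ c, IsSum a c b

def Lt (a b : E) : Prop := Le a b ∧ a ≠ b

/-- The orthosupplement `a⁻ = 1 - a`: the unique element with `a + a⁻ = 1`. -/
noncomputable def compl (a : E) : E := (existsUnique_compl a).choose

theorem isSum_compl (a : E) : IsSum a (compl a) 1 := (existsUnique_compl a).choose_spec.1

theorem compl_unique {a b : E} (h : IsSum a b 1) : b = compl a :=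
  (existsUnique_compl a).unique h (isSum_compl a)

theorem compl_compl (a : E) : compl (compl a) = a :=
  (compl_unique (isSum_comm (isSum_compl a))).symm

theorem compl_one : compl (1 : E) = 0 :=
  eq_zero_of_isSum_one (isSum_comm (isSum_compl 1))

theorem assoc_right {a b c d e : E} (h₁ : IsSum a b d) (h₂ : IsSum d c e) :
    ∃ f, IsSum b c f ∧ IsSum a f e := isSum_assoc.1 ⟨d, h₁, h₂⟩

theorem assoc_left {a b c f e : E} (h₁ : IsSum b c f) (h₂ : IsSum a f e) :
    ∃ d, IsSum a b d ∧ IsSum d c e := isSum_assoc.2 ⟨f, h₁, h₂⟩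

theorem isSum_zero (a : E) : IsSum a 0 a := by
  have h10 : IsSum (1 : E) 0 1 := by simpa [compl_one] using isSum_compl (1 : E)
  obtain ⟨f, hf, hf1⟩ := assoc_right (isSum_comm (isSum_compl a)) h10
  have : f = a := by rw [compl_unique hf1, compl_compl]
  rwa [this] at hf

theorem cancel {a b c d : E} (h₁ : IsSum a b d) (h₂ : IsSum a c d) : b = c := by
  obtain ⟨f, hf, hf1⟩ := assoc_right (isSum_comm h₁) (isSum_compl d)
  obtain ⟨g, hg, hg1⟩ := assoc_right (isSum_comm h₂) (isSum_compl d)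
  have : f = g := isSum_unique hf hg
  subst this
  rw [compl_unique (isSum_comm hf1), compl_unique (isSum_comm hg1)]

end Basic

/-- A homomorphism of effect algebras. -/
structure Hom (E F : Type*) [EffectAlgebra E] [EffectAlgebra F] where
  toFun : E → F
  map_one : toFun 1 = 1
  map_isSum : ∀ {a b c : E}, IsSum a b c → IsSum (toFun a) (toFun b) (toFun c)

/-- `E ≅ F`: there is a bijection `E → F` such that it and its inverse are homomorphisms. -/
def Isomorphic (E F : Type*) [EffectAlgebra E] [EffectAlgebra F] : Prop :=
  ∃ (f : Hom E F) (g : Hom F E),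
    Function.LeftInverse g.toFun f.toFun ∧ Function.RightInverse g.toFun f.toFun

/-- The Riesz Decomposition Property for effect algebras. -/
class RDP (E : Type*) [EffectAlgebra E] : Prop where
  refine_sum : ∀ {a₁ a₂ b₁ b₂ s : E}, IsSum a₁ a₂ s → IsSum b₁ b₂ s →
    ∃ c₁₁ c₁₂ c₂₁ c₂₂ : E, IsSum c₁₁ c₁₂ a₁ ∧ IsSum c₂₁ c₂₂ a₂ ∧
      IsSum c₁₁ c₂₁ b₁ ∧ IsSum c₁₂ c₂₂ b₂

/-- Effect subalgebras. -/
structure Subalgebra (E : Type*) [EffectAlgebra E] where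
  carrier : Set E
  one_mem : (1 : E) ∈ carrier
  compl_mem : ∀ {a : E}, a ∈ carrier → compl a ∈ carrier
  sum_mem : ∀ {a b c : E}, a ∈ carrier → b ∈ carrier → IsSum a b c → c ∈ carrier

/-- An effect subalgebra is an effect algebra under the restricted operations. -/
instance Subalgebra.instEffectAlgebra {E : Type*} [EffectAlgebra E] (F : Subalgebra E) :
    EffectAlgebra F.carrier where
  zero := ⟨0, by simpa [compl_one] using F.compl_mem F.one_mem⟩
  one := ⟨1, F.one_mem⟩
  IsSum a b c := IsSum (a : E) (b : E) (c : E)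
  isSum_unique h₁ h₂ := Subtype.ext (isSum_unique h₁ h₂)
  isSum_comm h := isSum_comm h
  isSum_assoc := by
    rintro a b c e
    constructor
    · rintro ⟨d, h₁, h₂⟩
      obtain ⟨f, hf, hf'⟩ := assoc_right h₁ h₂
      exact ⟨⟨f, F.sum_mem b.2 c.2 hf⟩, hf, hf'⟩
    · rintro ⟨f, h₁, h₂⟩
      obtain ⟨d, hd, hd'⟩ := assoc_left h₁ h₂
      exact ⟨⟨d, F.sum_mem a.2 b.2 hd⟩, hd, hd'⟩
  existsUnique_compl a :=
    ⟨⟨compl (a : E), F.compl_mem a.2⟩, isSum_compl (a : E),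
      fun _ hb => Subtype.ext (compl_unique hb)⟩
  eq_zero_of_isSum_one h := Subtype.ext (eq_zero_of_isSum_one h)

/-- The effect subalgebra generated by a set `s`: the smallest one that contains `s`. -/
def Subalgebra.closure {E : Type*} [EffectAlgebra E] (s : Set E) : Subalgebra E where
  carrier := {x | ∀ F : Subalgebra E, s ⊆ F.carrier → x ∈ F.carrier}
  one_mem F _ := F.one_mem
  compl_mem ha F hF := F.compl_mem (ha F hF)
  sum_mem ha hb h F hF := F.sum_mem (ha F hF) (hb F hF) h

end EffectAlgebra

open EffectAlgebra in
/-- Ideals of an effect algebra. -/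
structure EffectIdeal (E : Type*) [EffectAlgebra E] where
  carrier : Set E
  nonempty : carrier.Nonempty
  mem_of_le : ∀ {a b : E}, Le a b → b ∈ carrier → a ∈ carrier
  sum_mem : ∀ {a b c : E}, a ∈ carrier → b ∈ carrier → IsSum a b c → c ∈ carrier

namespace EffectIdeal

open EffectAlgebra

variable {E : Type*} [EffectAlgebra E]

theorem zero_mem (I : EffectIdeal E) : (0 : E) ∈ I.carrier := by
  obtain ⟨a, ha⟩ := I.nonempty
  exact I.mem_of_le ⟨a, isSum_comm (isSum_zero a)⟩ ha

/-- The ideal generated by an element `a` (as a set): the intersection of all ideals that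
contain `a`. -/
def principal (a : E) : Set E :=
  {x | ∀ J : EffectIdeal E, a ∈ J.carrier → x ∈ J.carrier}

/-- `a ∼ b` modulo `I` iff `a - e = b - f` for some `e, f ∈ I` with `e ≤ a`, `f ≤ b`. -/
def Rel (I : EffectIdeal E) (a b : E) : Prop :=
  ∃ e ∈ I.carrier, ∃ f ∈ I.carrier, ∃ m : E, IsSum m e a ∧ IsSum m f b

theorem Rel.refl (I : EffectIdeal E) (a : E) : I.Rel a a :=
  ⟨0, I.zero_mem, 0, I.zero_mem, a, isSum_zero a, isSum_zero a⟩

theorem Rel.symm {I : EffectIdeal E} {a b : E} : I.Rel a b → I.Rel b a := by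
  rintro ⟨e, he, f, hf, m, h₁, h₂⟩
  exact ⟨f, hf, e, he, m, h₂, h₁⟩

theorem Rel.of_sum {I : EffectIdeal E} {a e b : E} (he : e ∈ I.carrier) (h : IsSum a e b) :
    I.Rel a b :=
  ⟨0, I.zero_mem, e, he, a, isSum_zero a, h⟩

theorem Rel.trans [RDP E] {I : EffectIdeal E} {a b c : E} :
    I.Rel a b → I.Rel b c → I.Rel a c := by
  rintro ⟨e, he, f, hf, m, hma, hmb⟩ ⟨g, hg, h, hh, n, hnb, hnc⟩
  obtain ⟨p, q, r, s, hpq, hrs, hpr, hqs⟩ := RDP.refine_sum hmb hnb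
  obtain ⟨k, hk, hk'⟩ := assoc_right hpq hma
  obtain ⟨l, hl, hl'⟩ := assoc_right hpr hnc
  exact ⟨k, I.sum_mem (I.mem_of_le ⟨s, hqs⟩ hg) he hk,
    l, I.sum_mem (I.mem_of_le ⟨s, hrs⟩ hf) hh hl, p, hk', hl'⟩

theorem rearrange {p e a q f b c : E} (ha : IsSum p e a) (hb : IsSum q f b)
    (hc : IsSum a b c) : ∃ m g, IsSum p q m ∧ IsSum e f g ∧ IsSum m g c := by
  obtain ⟨x, hx, hx'⟩ := assoc_right ha hc
  obtain ⟨y, hy, hy'⟩ := assoc_right hb (isSum_comm hx)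
  obtain ⟨m, hm, hm'⟩ := assoc_left hy' hx'
  exact ⟨m, y, hm, isSum_comm hy, hm'⟩

theorem Rel.sum {I : EffectIdeal E} {a a' b b' c c' : E} (ha : I.Rel a a') (hb : I.Rel b b')
    (hc : IsSum a b c) (hc' : IsSum a' b' c') : I.Rel c c' := by
  obtain ⟨e, he, e', he', p, hp, hp'⟩ := ha
  obtain ⟨f, hf, f', hf', q, hq, hq'⟩ := hb
  obtain ⟨m, g, hm, hg, hmg⟩ := rearrange hp hq hc
  obtain ⟨m', g', hm', hg', hmg'⟩ := rearrange hp' hq' hc'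
  obtain rfl : m = m' := isSum_unique hm hm'
  exact ⟨g, I.sum_mem he hf hg, g', I.sum_mem he' hf' hg', m, hmg, hmg'⟩

theorem Rel.assoc [RDP E] {I : EffectIdeal E} {a b c d d' e : E} (h₁ : IsSum a b d)
    (hd : I.Rel d d') (h₂ : IsSum d' c e) :
    ∃ a' b' f e', I.Rel a' a ∧ I.Rel b' b ∧ I.Rel e' e ∧ IsSum b' c f ∧ IsSum a' f e' := by
  obtain ⟨i, hi, j, hj, m, hm, hm'⟩ := hd
  obtain ⟨a₁, a₂, b₁, b₂, ha, hb, hab, hab'⟩ := RDP.refine_sum h₁ hm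
  obtain ⟨x, hx, hx'⟩ := assoc_right (isSum_comm hm') h₂
  obtain ⟨f, hf, hf'⟩ := assoc_right hab hx
  exact ⟨a₁, b₁, f, x, .of_sum (I.mem_of_le ⟨b₂, hab'⟩ hi) ha,
    .of_sum (I.mem_of_le ⟨a₂, isSum_comm hab'⟩ hi) hb, .of_sum hj (isSum_comm hx'), hf, hf'⟩

theorem Rel.compl [RDP E] {I : EffectIdeal E} {a b c : E} (h : IsSum a b c) (hc : I.Rel c 1) :
    I.Rel b (EffectAlgebra.compl a) := by
  obtain ⟨i, hi, j, hj, p, hp, hp'⟩ := hc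
  obtain ⟨a₁, a₂, b₁, b₂, ha, hb, hab, hab'⟩ := RDP.refine_sum h hp
  obtain ⟨x, hx, hx'⟩ := assoc_right hab hp'
  obtain ⟨y, hy, hy'⟩ := assoc_right ha (isSum_compl a)
  obtain rfl : x = y := cancel hx' hy'
  have h1 : I.Rel b₁ b := .of_sum (I.mem_of_le ⟨a₂, isSum_comm hab'⟩ hi) hb
  have h2 : I.Rel b₁ x := .of_sum hj hx
  have h3 : I.Rel (EffectAlgebra.compl a) x :=
    .of_sum (I.mem_of_le ⟨b₂, hab'⟩ hi) (isSum_comm hy)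
  exact h1.symm.trans (h2.trans h3.symm)

theorem Rel.eq_zero {I : EffectIdeal E} {a b c : E} (h : IsSum a b c) (hb : I.Rel b 1) :
    I.Rel a 0 := by
  obtain ⟨i, hi, j, hj, p, hp, hp'⟩ := hb
  obtain ⟨x, hx, hx'⟩ := assoc_left hp h
  obtain ⟨y, hy, hy'⟩ := assoc_right (isSum_comm hx) (isSum_compl x)
  obtain rfl : y = j := cancel hy' hp'
  exact Rel.symm (.of_sum (I.mem_of_le ⟨_, hy⟩ hj) (isSum_comm (isSum_zero a)))

/-- Congruence modulo an ideal of an effect algebra with RDP. -/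
def setoid [RDP E] (I : EffectIdeal E) : Setoid E where
  r := I.Rel
  iseqv := ⟨Rel.refl I, Rel.symm, Rel.trans⟩

/-- The quotient `E/I`. -/
def Quot [RDP E] (I : EffectIdeal E) := Quotient I.setoid

/-- The canonical projection `E → E/I`. -/
def proj [RDP E] (I : EffectIdeal E) (a : E) : I.Quot := Quotient.mk I.setoid a

theorem proj_eq_proj [RDP E] {I : EffectIdeal E} {a b : E} : I.proj a = I.proj b ↔ I.Rel a b :=
  Quotient.eq (r := I.setoid)

theorem proj_surjective [RDP E] (I : EffectIdeal E) : Function.Surjective I.proj :=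
  Quotient.mk_surjective

/-- The quotient effect algebra: `x + y = z` in `E/I` iff `a + b = c` for some representatives. -/
instance instEffectAlgebraQuot [RDP E] (I : EffectIdeal E) : EffectAlgebra I.Quot where
  zero := I.proj 0
  one := I.proj 1
  IsSum x y z := ∃ a b c : E, I.proj a = x ∧ I.proj b = y ∧ I.proj c = z ∧ IsSum a b c
  isSum_unique := by
    rintro x y z t ⟨a, b, c, ha, hb, rfl, h⟩ ⟨a', b', c', ha', hb', rfl, h'⟩
    exact proj_eq_proj.2 (Rel.sum (proj_eq_proj.1 (ha.trans ha'.symm)) (proj_eq_proj.1 (hb.trans hb'.symm)) h h')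
  isSum_comm := by
    rintro x y z ⟨a, b, c, ha, hb, hc, h⟩
    exact ⟨b, a, c, hb, ha, hc, isSum_comm h⟩
  isSum_assoc := by
    rintro x y z t
    constructor
    · rintro ⟨w, ⟨a, b, d, rfl, rfl, rfl, h₁⟩, ⟨d', c, e, hd, rfl, rfl, h₂⟩⟩
      obtain ⟨a', b', f, e', ha, hb, he, h, h'⟩ := Rel.assoc h₁ (proj_eq_proj.1 hd.symm) h₂
      exact ⟨I.proj f, ⟨b', c, f, proj_eq_proj.2 hb, rfl, rfl, h⟩,
        ⟨a', f, e', proj_eq_proj.2 ha, rfl, proj_eq_proj.2 he, h'⟩⟩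
    · rintro ⟨w, ⟨b, c, d, rfl, rfl, rfl, h₁⟩, ⟨a, d', e, rfl, hd, rfl, h₂⟩⟩
      obtain ⟨c', b', f, e', hc, hb, he, h, h'⟩ :=
        Rel.assoc (isSum_comm h₁) (proj_eq_proj.1 hd.symm) (isSum_comm h₂)
      exact ⟨I.proj f, ⟨a, b', f, rfl, proj_eq_proj.2 hb, rfl, isSum_comm h⟩,
        ⟨f, c', e', rfl, proj_eq_proj.2 hc, proj_eq_proj.2 he, isSum_comm h'⟩⟩
  existsUnique_compl := by
    intro x
    obtain ⟨a, rfl⟩ := I.proj_surjective x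
    refine ⟨I.proj (EffectAlgebra.compl a),
      ⟨a, _, 1, rfl, rfl, rfl, isSum_compl a⟩, ?_⟩
    rintro y ⟨a', b, c, ha, rfl, hc, h⟩
    have h1 := Rel.compl h (proj_eq_proj.1 hc)
    have h2 : I.Rel (EffectAlgebra.compl a') (EffectAlgebra.compl a) := by
      obtain ⟨e, he, f, hf, m, hm, hm'⟩ := proj_eq_proj.1 ha
      obtain ⟨s, hs, hs'⟩ := assoc_right hm (isSum_compl a')
      obtain ⟨t, ht, ht'⟩ := assoc_right hm' (isSum_compl a)
      obtain rfl : s = t := cancel hs' ht'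
      exact Rel.trans (.of_sum he (isSum_comm hs)) (Rel.symm (.of_sum hf (isSum_comm ht)))
    exact proj_eq_proj.2 (h1.trans h2)
  eq_zero_of_isSum_one := by
    rintro x z ⟨a, b, c, rfl, hb, -, h⟩
    exact proj_eq_proj.2 (Rel.eq_zero h (proj_eq_proj.1 hb))

/-- `I` is strict: `x/I < y/I` implies `x < y`. -/
def IsStrict [RDP E] (I : EffectIdeal E) : Prop :=
  ∀ x y : E, Lt (I.proj x) (I.proj y) → Lt x y

/-- `I` is retractive: `E → E/I` has a right inverse that is a homomorphism `E/I → E`. -/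
def IsRetractive [RDP E] (I : EffectIdeal E) : Prop :=
  ∃ δ : Hom I.Quot E, ∀ x, I.proj (δ.toFun x) = x

def IsPrime (I : EffectIdeal E) : Prop :=
  ∀ x y : E, principal x ∩ principal y ⊆ I.carrier → x ∈ I.carrier ∨ y ∈ I.carrier

/-- Lexicographic ideals. -/
structure IsLexicographic [RDP E] (I : EffectIdeal E) : Prop where
  ne_zero : I.carrier ≠ {0}
  ne_univ : I.carrier ≠ Set.univ
  strict : I.IsStrict
  retractive : I.IsRetractive
  prime : I.IsPrime

end EffectIdeal

/-- A poset is an antilattice if only comparable elements have an infimum or a supremum. -/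
def IsAntilattice (P : Type*) [PartialOrder P] : Prop :=
  ∀ a b : P, ((∃ c, IsGLB {a, b} c) ∨ (∃ c, IsLUB {a, b} c)) → a ≤ b ∨ b ≤ a

/-- The Riesz Decomposition Property for Abelian po-groups. -/
def GroupRDP (G : Type*) [AddCommGroup G] [PartialOrder G] : Prop :=
  ∀ a₁ a₂ b₁ b₂ : G, 0 ≤ a₁ → 0 ≤ a₂ → 0 ≤ b₁ → 0 ≤ b₂ → a₁ + a₂ = b₁ + b₂ →
    ∃ c₁₁ c₁₂ c₂₁ c₂₂ : G, 0 ≤ c₁₁ ∧ 0 ≤ c₁₂ ∧ 0 ≤ c₂₁ ∧ 0 ≤ c₂₂ ∧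
      a₁ = c₁₁ + c₁₂ ∧ a₂ = c₂₁ + c₂₂ ∧ b₁ = c₁₁ + c₂₁ ∧ b₂ = c₁₂ + c₂₂

/-- `u` is a strong unit of the po-group `G`. -/
structure IsStrongUnit {G : Type*} [AddCommGroup G] [PartialOrder G] (u : G) : Prop where
  nonneg : 0 ≤ u
  exists_le_nsmul : ∀ g : G, ∃ n : ℕ, g ≤ n • u

/-- `Γ(G, u) = [0, u]`. -/
def Gamma (G : Type*) [AddCommGroup G] [PartialOrder G] (u : G) (_hu : 0 ≤ u) : Type _ :=
  Set.Icc (0 : G) u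

/-- The effect algebra structure of `Γ(G, u)`: `a + b` is defined iff `a + b ≤ u`, and is then the
sum in `G`. -/
instance Gamma.instEffectAlgebra (G : Type*) [AddCommGroup G] [PartialOrder G]
    [IsOrderedAddMonoid G] (u : G) (hu : 0 ≤ u) : EffectAlgebra (Gamma G u hu) where
  zero := ⟨0, le_rfl, hu⟩
  one := ⟨u, hu, le_rfl⟩
  IsSum a b c := a.1 + b.1 = c.1
  isSum_unique h₁ h₂ := Subtype.ext (h₁.symm.trans h₂)
  isSum_comm h := (add_comm _ _).trans h
  isSum_assoc := by
    rintro ⟨a, ha⟩ ⟨b, hb⟩ ⟨c, hc⟩ ⟨e, he⟩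
    constructor
    · rintro ⟨⟨d, hd⟩, h₁, h₂⟩
      simp only at h₁ h₂
      have h : a + (b + c) = e := by rw [← h₂, ← h₁, add_assoc]
      refine ⟨⟨b + c, add_nonneg hb.1 hc.1, ?_⟩, rfl, h⟩
      exact (le_add_of_nonneg_left ha.1).trans (h.le.trans he.2)
    · rintro ⟨⟨d, hd⟩, h₁, h₂⟩
      simp only at h₁ h₂
      have h : a + b + c = e := by rw [← h₂, ← h₁, add_assoc]
      refine ⟨⟨a + b, add_nonneg ha.1 hb.1, ?_⟩, rfl, h⟩
      exact (le_add_of_nonneg_right hc.1).trans (h.le.trans he.2)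
  existsUnique_compl := by
    rintro ⟨a, ha⟩
    refine ⟨⟨u - a, sub_nonneg.2 ha.2, sub_le_self _ ha.1⟩, add_sub_cancel a u, ?_⟩
    rintro ⟨b, hb⟩ h
    exact Subtype.ext (eq_sub_of_add_eq' h)
  eq_zero_of_isSum_one := by
    rintro ⟨a, ha⟩ ⟨c, hc⟩ h
    refine Subtype.ext (le_antisymm ?_ ha.1)
    have h' : a + u = c := h
    exact nonpos_of_add_le_left (h'.le.trans hc.2)

/-- `(u, 0) ≥ 0` in the lexicographic product `H ×ₗ G`, whose order is `(h₁, g₁) ≤ (h₂, g₂)` iff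
`h₁ < h₂`, or `h₁ = h₂` and `g₁ ≤ g₂`. -/
theorem toLex_nonneg {H G : Type*} [AddCommGroup H] [PartialOrder H] [AddCommGroup G]
    [PartialOrder G] {u : H} (hu : 0 ≤ u) : (0 : H ×ₗ G) ≤ toLex (u, 0) := by
  rw [Prod.Lex.le_iff]
  rcases hu.lt_or_eq with h | h
  · exact Or.inl h
  · exact Or.inr ⟨h, le_rfl⟩

/-- `Γ(H ×ₗ G, (u, 0))`. -/
abbrev LexGamma (H G : Type*) [AddCommGroup H] [PartialOrder H] [AddCommGroup G]
    [PartialOrder G] (u : H) (hu : 0 ≤ u) : Type _ :=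
  Gamma (H ×ₗ G) (toLex (u, 0)) (toLex_nonneg hu)

/-! An effect algebra E with RDP is an interval [0, v] of a po-group (Ravindran's theorem). Words in
E are identified when they have a common refinement. RDP makes this relation transitive
(`Refines.wordEquiv_of_refines`), cancellation in E makes the quotient monoid cancellative
(`WordEquiv.cancel_singleton`), and words with the same defined sum are identified
(`wordEquiv_of_wordSum_eq`), so E is an interval in the group of differences of that monoid.

Given a lexicographic ideal I, represent E by ψ in a po-group K and E/I by χ in (H, u). Strictness
makes all sums inside I defined, so ψ(I) is the positive cone of the subgroup G = ψ(I) - ψ(I) of K.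
With a section δ of the projection, x ↦ (χ(x/I), ψ(x) - ψ(δ(x/I))) identifies E with the interval of
H ×ₗ G: strictness also ensures that every element of G occurs over each class strictly between 0
and 1. Primeness says that E/I has no two nonzero disjoint elements, which makes H an antilattice.

Conversely, I consists of the elements with first coordinate 0. The lexicographic product inherits
RDP because second coordinates are constrained only where first coordinates vanish (`GroupRDP.lex`);
h ↦ (h, 0) gives the section, and the antilattice property gives primeness.

In both directions ⟨I⟩ is I together with the complements of its elements: these are the levels 0
and 1 of ℤ ×ₗ G. -/

namespace EffectAlgebra

/-! ### Words in an effect algebra, up to common refinement -/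

section Words

variable {E : Type*} [EffectAlgebra E]

theorem isSum_zero_left (a : E) : IsSum 0 a a := isSum_comm (isSum_zero a)

/-- Adding 1 to a + b = 0 shows that b + 1 is defined, which forces b = 0. -/
theorem eq_zero_of_isSum_zero {a b : E} (h : IsSum a b 0) : a = 0 := by
  obtain ⟨f, hf, hf'⟩ := assoc_right h (isSum_zero_left (1 : E))
  have hb : b = 0 := eq_zero_of_isSum_one hf
  subst hb
  exact isSum_unique (isSum_zero a) h

theorem Le.of_isSum_right {a b c : E} (h : IsSum a b c) : Le b c := ⟨a, isSum_comm h⟩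

/-- The elements of `E` together with a value for undefined sums. -/
inductive PartialSum (E : Type*)
  | undefined : PartialSum E
  | of : E → PartialSum E

open Classical in
/-- Addition of `E`, made total. -/
noncomputable def PartialSum.add (x y : PartialSum E) : PartialSum E :=
  if h : ∃ c a b, x = of a ∧ y = of b ∧ IsSum a b c then of h.choose else undefined

theorem PartialSum.of_injective {E : Type*} : Function.Injective (of : E → PartialSum E) :=
  fun _ _ h => of.inj h

theorem PartialSum.add_eq_of {x y : PartialSum E} {c : E} :
    PartialSum.add x y = of c ↔ ∃ a b, x = of a ∧ y = of b ∧ IsSum a b c := by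
  unfold PartialSum.add
  split_ifs with h
  · obtain ⟨a, b, hx, hy, hab⟩ := h.choose_spec
    constructor
    · intro hc
      exact ⟨a, b, hx, hy, of_injective hc ▸ hab⟩
    · rintro ⟨a', b', hx', hy', h'⟩
      cases of_injective (hx.symm.trans hx')
      cases of_injective (hy.symm.trans hy')
      rw [isSum_unique hab h']
  · exact ⟨fun hc => (by cases hc), fun hc => absurd ⟨c, hc⟩ h⟩

theorem PartialSum.ext {E : Type*} {x y : PartialSum E} (h : ∀ c, x = of c ↔ y = of c) : x = y := by
  rcases x with _ | a
  · rcases y with _ | b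
    · rfl
    · exact (h b).2 rfl
  · exact ((h a).1 rfl).symm

noncomputable instance : Add (PartialSum E) := ⟨PartialSum.add⟩

instance : Zero (PartialSum E) := ⟨PartialSum.of 0⟩

/-- Associativity in E is an equivalence of definedness as well as of values, so it survives when
undefined sums become an absorbing element. Values of words are then ordinary multiset sums. -/
noncomputable instance : AddCommMonoid (PartialSum E) where
  add_assoc x y z := PartialSum.ext fun e => by
    refine PartialSum.add_eq_of.trans (Iff.trans ?_ PartialSum.add_eq_of.symm)
    constructor
    · rintro ⟨d, c, hd, hc, h⟩
      obtain ⟨a, b, ha, hb, h'⟩ := PartialSum.add_eq_of.1 hd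
      obtain ⟨f, hf, hf'⟩ := assoc_right h' h
      exact ⟨a, f, ha, PartialSum.add_eq_of.2 ⟨b, c, hb, hc, hf⟩, hf'⟩
    · rintro ⟨a, d, ha, hd, h⟩
      obtain ⟨b, c, hb, hc, h'⟩ := PartialSum.add_eq_of.1 hd
      obtain ⟨f, hf, hf'⟩ := assoc_left h' h
      exact ⟨f, c, PartialSum.add_eq_of.2 ⟨a, b, ha, hb, hf⟩, hc, hf'⟩
  add_comm x y := PartialSum.ext fun e => by
    refine PartialSum.add_eq_of.trans (Iff.trans ?_ PartialSum.add_eq_of.symm)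
    exact ⟨fun ⟨a, b, ha, hb, h⟩ => ⟨b, a, hb, ha, isSum_comm h⟩,
      fun ⟨a, b, ha, hb, h⟩ => ⟨b, a, hb, ha, isSum_comm h⟩⟩
  zero_add x := PartialSum.ext fun e => by
    refine PartialSum.add_eq_of.trans ?_
    constructor
    · rintro ⟨a, b, ha, hb, h⟩
      cases PartialSum.of_injective ha
      rw [hb, isSum_unique h (isSum_zero_left b)]
    · rintro rfl
      exact ⟨0, e, rfl, rfl, isSum_zero_left e⟩
  add_zero x := PartialSum.ext fun e => by
    refine PartialSum.add_eq_of.trans ?_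
    constructor
    · rintro ⟨a, b, ha, hb, h⟩
      cases PartialSum.of_injective hb
      rw [ha, isSum_unique h (isSum_zero a)]
    · rintro rfl
      exact ⟨e, 0, rfl, rfl, isSum_zero e⟩
  nsmul := nsmulRec

open PartialSum

theorem PartialSum.add_eq_of_iff {x y : PartialSum E} {c : E} :
    x + y = of c ↔ ∃ a b, x = of a ∧ y = of b ∧ IsSum a b c := PartialSum.add_eq_of

theorem PartialSum.of_add_of {a b c : E} : (of a + of b : PartialSum E) = of c ↔ IsSum a b c := by
  rw [add_eq_of_iff]
  constructor
  · rintro ⟨a', b', ha, hb, h⟩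
    cases of_injective ha; cases of_injective hb; exact h
  · exact fun h => ⟨a, b, rfl, rfl, h⟩

/-- The value of a word. -/
noncomputable def wordSum (s : Multiset E) : PartialSum E := (s.map of).sum

@[simp] theorem wordSum_zero : wordSum (0 : Multiset E) = of 0 := rfl

@[simp] theorem wordSum_cons (a : E) (s : Multiset E) : wordSum (a ::ₘ s) = of a + wordSum s := by
  simp [wordSum]

@[simp] theorem wordSum_add (s t : Multiset E) : wordSum (s + t) = wordSum s + wordSum t := by
  simp [wordSum]

@[simp] theorem wordSum_singleton (a : E) : wordSum ({a} : Multiset E) = of a := by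
  simp [wordSum]

/-- `t` arises from the word `s` by replacing each letter by a word with that letter as its sum. -/
def Refines (s t : Multiset E) : Prop :=
  ∃ T : Multiset (Multiset E), Multiset.Rel (fun a c => wordSum c = of a) s T ∧ T.sum = t

theorem Refines.zero_iff {t : Multiset E} : Refines 0 t ↔ t = 0 := by
  simp [Refines, eq_comm]

theorem Refines.add_iff {s₁ s₂ t : Multiset E} :
    Refines (s₁ + s₂) t ↔ ∃ t₁ t₂, Refines s₁ t₁ ∧ Refines s₂ t₂ ∧ t = t₁ + t₂ := by
  constructor
  · rintro ⟨T, hT, rfl⟩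
    obtain ⟨T₁, T₂, h₁, h₂, rfl⟩ := Multiset.rel_add_left.1 hT
    exact ⟨_, _, ⟨T₁, h₁, rfl⟩, ⟨T₂, h₂, rfl⟩, by simp⟩
  · rintro ⟨_, _, ⟨T₁, h₁, rfl⟩, ⟨T₂, h₂, rfl⟩, rfl⟩
    exact ⟨T₁ + T₂, h₁.add h₂, by simp⟩

theorem Refines.singleton_iff {a : E} {t : Multiset E} : Refines {a} t ↔ wordSum t = of a := by
  constructor
  · rintro ⟨T, hT, rfl⟩
    rw [← Multiset.cons_zero, Multiset.rel_cons_left] at hT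
    obtain ⟨c, T', hc, hT', rfl⟩ := hT
    rw [Multiset.rel_zero_left.1 hT']
    simpa using hc
  · intro h
    refine ⟨{t}, ?_, by simp⟩
    rw [← Multiset.cons_zero, ← Multiset.cons_zero]
    exact .cons h .zero

theorem Refines.cons_iff {a : E} {s t : Multiset E} :
    Refines (a ::ₘ s) t ↔ ∃ c t', wordSum c = of a ∧ Refines s t' ∧ t = c + t' := by
  rw [← Multiset.singleton_add, Refines.add_iff]
  simp only [Refines.singleton_iff]

theorem Refines.add {s₁ s₂ t₁ t₂ : Multiset E} (h₁ : Refines s₁ t₁) (h₂ : Refines s₂ t₂) :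
    Refines (s₁ + s₂) (t₁ + t₂) := Refines.add_iff.2 ⟨_, _, h₁, h₂, rfl⟩

theorem Refines.refl (s : Multiset E) : Refines s s := by
  induction s using Multiset.induction_on with
  | empty => exact Refines.zero_iff.2 rfl
  | cons a s ih => exact Refines.cons_iff.2 ⟨{a}, s, by simp, ih, by simp⟩

theorem Refines.wordSum_eq {s t : Multiset E} (h : Refines s t) : wordSum t = wordSum s := by
  induction s using Multiset.induction_on generalizing t with
  | empty => rw [Refines.zero_iff.1 h]
  | cons a s ih =>
    obtain ⟨c, t', hc, ht, rfl⟩ := Refines.cons_iff.1 h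
    simp [hc, ih ht]

theorem Refines.trans {s t r : Multiset E} (h : Refines s t) (h' : Refines t r) : Refines s r := by
  induction s using Multiset.induction_on generalizing t r with
  | empty => rw [Refines.zero_iff.1 h] at h'; exact h'
  | cons a s ih =>
    obtain ⟨c, t', hc, ht, rfl⟩ := Refines.cons_iff.1 h
    obtain ⟨r₁, r₂, h₁, h₂, rfl⟩ := Refines.add_iff.1 h'
    exact Refines.cons_iff.2 ⟨r₁, r₂, h₁.wordSum_eq.trans hc, ih ht h₂, rfl⟩

/-- Words with a common refinement. -/
def WordEquiv (s t : Multiset E) : Prop := ∃ r, Refines s r ∧ Refines t r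

theorem WordEquiv.symm {s t : Multiset E} : WordEquiv s t → WordEquiv t s :=
  fun ⟨r, h, h'⟩ => ⟨r, h', h⟩

theorem Refines.wordEquiv {s t : Multiset E} (h : Refines s t) : WordEquiv s t :=
  ⟨t, h, Refines.refl t⟩

theorem WordEquiv.add {s₁ s₂ t₁ t₂ : Multiset E} : WordEquiv s₁ t₁ → WordEquiv s₂ t₂ →
    WordEquiv (s₁ + s₂) (t₁ + t₂) :=
  fun ⟨r, h, h'⟩ ⟨q, k, k'⟩ => ⟨r + q, h.add k, h'.add k'⟩

theorem WordEquiv.wordSum_eq {s t : Multiset E} : WordEquiv s t → wordSum s = wordSum t :=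
  fun ⟨_, h, h'⟩ => h.wordSum_eq.symm.trans h'.wordSum_eq

/-- A common refinement is split as p₁ + p₂ and as q₁ + q₂; intersecting these splittings as
multisets gives the four blocks. -/
theorem WordEquiv.exists_refinement {s₁ s₂ t₁ t₂ : Multiset E}
    (h : WordEquiv (s₁ + s₂) (t₁ + t₂)) :
    ∃ c₁₁ c₁₂ c₂₁ c₂₂, WordEquiv s₁ (c₁₁ + c₁₂) ∧ WordEquiv s₂ (c₂₁ + c₂₂) ∧
      WordEquiv t₁ (c₁₁ + c₂₁) ∧ WordEquiv t₂ (c₁₂ + c₂₂) := by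
  classical
  obtain ⟨r, h₁, h₂⟩ := h
  obtain ⟨p₁, p₂, hp₁, hp₂, rfl⟩ := Refines.add_iff.1 h₁
  obtain ⟨q₁, q₂, hq₁, hq₂, he⟩ := Refines.add_iff.1 h₂
  have hcount : ∀ x, p₁.count x + p₂.count x = q₁.count x + q₂.count x := fun x => by
    simpa using congrArg (Multiset.count x) he
  refine ⟨p₁ ∩ q₁, p₁ - q₁, q₁ - p₁, p₂ - (q₁ - p₁), ?_, ?_, ?_, ?_⟩
  · convert hp₁.wordEquiv using 1; ext x; simp; omega
  · convert hp₂.wordEquiv using 1; ext x; have := hcount x; simp; omega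
  · convert hq₁.wordEquiv using 1; ext x; simp; omega
  · convert hq₂.wordEquiv using 1; ext x; have := hcount x; simp; omega

theorem WordEquiv.eq_zero_of_add {s t : Multiset E} (h : WordEquiv (s + t) 0) :
    WordEquiv s 0 := by
  obtain ⟨r, h₁, h₂⟩ := h
  cases Refines.zero_iff.1 h₂
  obtain ⟨p, q, hp, -, he⟩ := Refines.add_iff.1 h₁
  cases (add_eq_zero.1 he.symm).1
  exact hp.wordEquiv

variable [RDP E]

/-- RDP is applied letter by letter: refining b + c = x + y, with b the first letter and c the sum
of the rest, cuts b into two letters and leaves a splitting of c for the induction. -/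
theorem exists_refines_of_wordSum_eq_add {t : Multiset E} {x y a : E} (h : wordSum t = of a)
    (hxy : IsSum x y a) :
    ∃ t₁ t₂, wordSum t₁ = of x ∧ wordSum t₂ = of y ∧ Refines t (t₁ + t₂) := by
  induction t using Multiset.induction_on generalizing x y a with
  | empty =>
    have ha : a = 0 := (of_injective h).symm
    subst ha
    have hx := eq_zero_of_isSum_zero hxy
    have hy := eq_zero_of_isSum_zero (isSum_comm hxy)
    subst hx hy
    exact ⟨0, 0, rfl, rfl, Refines.refl _⟩
  | cons b t ih =>
    rw [wordSum_cons, add_eq_of_iff] at h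
    obtain ⟨b', c, hb, hc, hbc⟩ := h
    cases of_injective hb
    obtain ⟨b₁, b₂, c₁, c₂, h₁, h₂, h₃, h₄⟩ := RDP.refine_sum hbc hxy
    obtain ⟨t₁, t₂, k₁, k₂, k⟩ := ih hc h₂
    refine ⟨b₁ ::ₘ t₁, b₂ ::ₘ t₂, ?_, ?_, ?_⟩
    · rw [wordSum_cons, k₁, of_add_of]; exact h₃
    · rw [wordSum_cons, k₂, of_add_of]; exact h₄
    · refine Refines.cons_iff.2 ⟨b₁ ::ₘ {b₂}, t₁ + t₂, ?_, k, ?_⟩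
      · rw [wordSum_cons, wordSum_singleton, of_add_of]; exact h₁
      · simp only [← Multiset.singleton_add]; abel

/-- For s = x + s', the word t refines to a part with sum x and a part with the same sum as s'; the
first part replaces the letter x, and induction handles the rest. -/
theorem wordEquiv_of_wordSum_eq {s t : Multiset E} {a : E} (hs : wordSum s = of a)
    (ht : wordSum t = of a) : WordEquiv s t := by
  induction s using Multiset.induction_on generalizing t a with
  | empty =>
    have ha : a = 0 := (of_injective hs).symm
    subst ha
    refine ⟨0, Refines.refl _, ?_⟩
    induction t using Multiset.induction_on with
    | empty => exact Refines.refl _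
    | cons b t ih =>
      rw [wordSum_cons, add_eq_of_iff] at ht
      obtain ⟨b', c, hb, hc, hbc⟩ := ht
      cases of_injective hb
      cases eq_zero_of_isSum_zero hbc
      cases eq_zero_of_isSum_zero (isSum_comm hbc)
      -- The empty word has sum 0, so it may replace a letter 0.
      exact Refines.cons_iff.2 ⟨0, 0, rfl, ih hc, rfl⟩
  | cons x s ih =>
    rw [wordSum_cons, add_eq_of_iff] at hs
    obtain ⟨x', y, hx, hy, hxy⟩ := hs
    cases of_injective hx
    obtain ⟨t₁, t₂, h₁, h₂, h⟩ := exists_refines_of_wordSum_eq_add ht hxy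
    obtain ⟨r, hr, hr'⟩ := ih hy h₂
    exact ⟨t₁ + r, Refines.cons_iff.2 ⟨t₁, r, h₁, hr, rfl⟩,
      h.trans ((Refines.refl t₁).add hr')⟩

/-- Both replacements of a letter have that letter as sum, hence are equivalent. This confluence is
what transitivity needs. -/
theorem Refines.wordEquiv_of_refines {s t t' : Multiset E} (h : Refines s t) (h' : Refines s t') :
    WordEquiv t t' := by
  induction s using Multiset.induction_on generalizing t t' with
  | empty => rw [Refines.zero_iff.1 h, Refines.zero_iff.1 h']; exact (Refines.refl _).wordEquiv
  | cons a s ih =>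
    obtain ⟨c, t, hc, ht, rfl⟩ := Refines.cons_iff.1 h
    obtain ⟨c', t', hc', ht', rfl⟩ := Refines.cons_iff.1 h'
    exact (wordEquiv_of_wordSum_eq hc hc').add (ih ht ht')

theorem WordEquiv.trans {s t r : Multiset E} : WordEquiv s t → WordEquiv t r → WordEquiv s r := by
  rintro ⟨p, h₁, h₂⟩ ⟨q, h₃, h₄⟩
  obtain ⟨m, k, k'⟩ := h₂.wordEquiv_of_refines h₃
  exact ⟨m, h₁.trans k, h₄.trans k'⟩

/-- A common refinement reads c + s' = d + t', where c and d both have sum a. By cancellation in E,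
c - d and d - c have the same sum, so they are equivalent; s' and t' differ only by exchanging these
two words. -/
theorem WordEquiv.cancel_singleton {a : E} {s t : Multiset E}
    (h : WordEquiv ({a} + s) ({a} + t)) : WordEquiv s t := by
  classical
  obtain ⟨r, h₁, h₂⟩ := h
  obtain ⟨c, s', hc, hs, rfl⟩ := Refines.add_iff.1 h₁
  obtain ⟨d, t', hd, ht, he⟩ := Refines.add_iff.1 h₂
  rw [Refines.singleton_iff] at hc hd
  have hc' : c = c ∩ d + (c - d) := by ext x; simp; omega
  have hd' : d = c ∩ d + (d - c) := by ext x; simp; omega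
  have hcount : ∀ x, c.count x + s'.count x = d.count x + t'.count x := fun x => by
    simpa using congrArg (Multiset.count x) he
  have hs' : s' = (d - c) + (s' - (d - c)) := by ext x; have := hcount x; simp; omega
  have ht' : t' = (c - d) + (s' - (d - c)) := by ext x; have := hcount x; simp; omega
  rw [hc', wordSum_add, add_eq_of_iff] at hc
  rw [hd', wordSum_add, add_eq_of_iff] at hd
  obtain ⟨p, x, hp, hx, hpx⟩ := hc
  obtain ⟨q, y, hq, hy, hqy⟩ := hd
  cases of_injective (hp.symm.trans hq)
  cases cancel hpx hqy
  refine hs.wordEquiv.trans (.trans ?_ ht.wordEquiv.symm)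
  rw [hs', ht']
  exact (wordEquiv_of_wordSum_eq hy hx).add (Refines.refl _).wordEquiv

theorem WordEquiv.cancel {w s t : Multiset E} (h : WordEquiv (w + s) (w + t)) :
    WordEquiv s t := by
  induction w using Multiset.induction_on with
  | empty => simpa using h
  | cons a w ih =>
    rw [← Multiset.singleton_add, add_assoc, add_assoc] at h
    exact ih h.cancel_singleton

variable (E) in
/-- Equivalence of words is a congruence. -/
def wordCon : AddCon (Multiset E) where
  r := WordEquiv
  iseqv := ⟨fun s => (Refines.refl s).wordEquiv, .symm, .trans⟩
  add' := .add

end Words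

end EffectAlgebra

/-! ### The representing po-group -/

/-- A cancellative commutative monoid without nonzero inverses is the positive cone of a directed
po-group. -/
theorem exists_poGroup_of_monoid (M : Type v) [AddCommMonoid M] [IsCancelAdd M]
    (conical : ∀ a b : M, a + b = 0 → a = 0) :
    ∃ (G : Type v) (_ : AddCommGroup G) (_ : PartialOrder G) (_ : IsOrderedAddMonoid G)
      (f : M →+ G), Function.Injective f ∧ (∀ g, 0 ≤ g ↔ ∃ m, f m = g) ∧
        ∀ g, ∃ a b, g = f a - f b := by
  let G := Algebra.GrothendieckAddGroup M
  let f : M →+ G := Algebra.GrothendieckAddGroup.of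
  have hf : Function.Injective f := Algebra.GrothendieckAddGroup.of_injective
  let _ : PartialOrder G :=
    { le := fun a b => ∃ m, f m = b - a
      le_refl := fun a => ⟨0, by simp⟩
      le_trans := fun a b c ⟨m, hm⟩ ⟨n, hn⟩ => ⟨m + n, by rw [map_add, hm, hn]; abel⟩
      le_antisymm := fun a b ⟨m, hm⟩ ⟨n, hn⟩ => by
        have h : m + n = 0 := hf (by rw [map_add, hm, hn, map_zero]; abel)
        rw [conical m n h, map_zero] at hm
        exact (sub_eq_zero.1 hm.symm).symm }
  have le_def : ∀ a b : G, a ≤ b ↔ ∃ m, f m = b - a := fun _ _ => Iff.rfl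
  refine ⟨G, inferInstance, inferInstance, ⟨?_, ?_⟩, f, hf, ?_, ?_⟩
  · rintro a b ⟨m, hm⟩ c
    exact ⟨m, by rw [hm]; abel⟩
  · rintro a b ⟨m, hm⟩ c
    exact ⟨m, by rw [hm]; abel⟩
  · intro g
    rw [le_def, sub_zero]
  · intro g
    induction g using AddLocalization.induction_on with
    | H y =>
      refine ⟨y.1, y.2, ?_⟩
      rw [eq_sub_iff_add_eq]
      have := (AddLocalization.addMonoidOf (⊤ : AddSubmonoid M)).mk'_spec y.1 y.2
      rwa [← AddLocalization.mk_eq_addMonoidOf_mk'] at this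

open EffectAlgebra PartialSum

/-- `f` is an isomorphism of `E` with `Γ(K, u)`. -/
structure IsGammaRep {E K : Type*} [EffectAlgebra E] [AddCommGroup K] [PartialOrder K]
    (f : E → K) (u : K) : Prop where
  injective : Function.Injective f
  isSum_iff : ∀ {a b c}, IsSum a b c ↔ f a + f b = f c
  exists_iff : ∀ {k}, (∃ a, f a = k) ↔ 0 ≤ k ∧ k ≤ u
  map_one : f 1 = u

/-- An effect algebra with RDP is an interval in a unital po-group with RDP. -/
theorem EffectAlgebra.exists_isGammaRep (E : Type v) [EffectAlgebra E] [RDP E] :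
    ∃ (K : Type v) (_ : AddCommGroup K) (_ : PartialOrder K) (_ : IsOrderedAddMonoid K)
      (u : K) (f : E → K), IsStrongUnit u ∧ GroupRDP K ∧ IsGammaRep f u := by
  let M := (wordCon E).Quotient
  let q : Multiset E →+ M := (wordCon E).mk'
  have hq : Function.Surjective q := AddCon.mk'_surjective
  have q_eq : ∀ s t, q s = q t ↔ WordEquiv s t := fun s t => (wordCon E).eq
  have : IsCancelAdd M := by
    refine @AddCommMagma.IsLeftCancelAdd.toIsCancelAdd M _ ⟨fun w s t h => ?_⟩
    obtain ⟨w, rfl⟩ := hq w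
    obtain ⟨s, rfl⟩ := hq s
    obtain ⟨t, rfl⟩ := hq t
    simp only [← map_add, q_eq] at h
    exact (q_eq _ _).2 h.cancel
  have conical : ∀ a b : M, a + b = 0 → a = 0 := fun a b h => by
    obtain ⟨s, rfl⟩ := hq a
    obtain ⟨t, rfl⟩ := hq b
    rw [← map_add, ← map_zero q, q_eq] at h
    rw [← map_zero q, q_eq]
    exact h.eq_zero_of_add
  obtain ⟨K, i₁, i₂, i₃, φ, hφ, hpos, hdiff⟩ := exists_poGroup_of_monoid M conical
  have hpos' : ∀ k : K, 0 ≤ k ↔ ∃ s, φ (q s) = k := fun k => by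
    rw [hpos]
    exact ⟨fun ⟨m, hm⟩ => by obtain ⟨s, rfl⟩ := hq m; exact ⟨s, hm⟩, fun ⟨s, hs⟩ => ⟨_, hs⟩⟩
  have hφq : ∀ s t, φ (q s) = φ (q t) ↔ WordEquiv s t := fun s t => hφ.eq_iff.trans (q_eq s t)
  have h_nonneg : ∀ s, 0 ≤ φ (q s) := fun s => (hpos' _).2 ⟨s, rfl⟩
  have h_single : ∀ a b : E, WordEquiv {a} {b} ↔ a = b := fun a b =>
    ⟨fun h => of_injective (by simpa using h.wordSum_eq), by
      rintro rfl; exact (Refines.refl _).wordEquiv⟩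
  have h_sum : ∀ {s : Multiset E} {a : E}, φ (q s) = φ (q {a}) ↔ wordSum s = of a := by
    intro s a
    rw [hφq]
    exact ⟨fun h => by simpa using h.wordSum_eq,
      fun h => wordEquiv_of_wordSum_eq h (by simp)⟩
  have h_isSum : ∀ {a b c : E}, IsSum a b c ↔ φ (q {a}) + φ (q {b}) = φ (q {c}) := by
    intro a b c
    rw [← map_add, ← map_add, h_sum, wordSum_add, wordSum_singleton, wordSum_singleton, of_add_of]
  refine ⟨K, i₁, i₂, i₃, φ (q {1}), fun a => φ (q {a}), ⟨h_nonneg _, fun g => ?_⟩, ?_,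
    ⟨?_, h_isSum, ?_, rfl⟩⟩
  · obtain ⟨a, b, rfl⟩ := hdiff g
    obtain ⟨s, rfl⟩ := hq a
    obtain ⟨t, rfl⟩ := hq b
    -- Each letter is at most 1, so a word is bounded by its length times the unit.
    refine ⟨s.card, (sub_le_self _ (h_nonneg t)).trans ?_⟩
    clear hdiff
    induction s using Multiset.induction_on with
    | empty => simp
    | cons a s ih =>
      rw [← Multiset.singleton_add, map_add, map_add, Multiset.card_add, Multiset.card_singleton,
        add_smul, one_smul]
      refine add_le_add ?_ ih
      rw [← h_isSum.1 (isSum_compl a)]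
      exact le_add_of_nonneg_right (h_nonneg _)
  · intro a₁ a₂ b₁ b₂ ha₁ ha₂ hb₁ hb₂ h
    obtain ⟨s₁, rfl⟩ := (hpos' _).1 ha₁
    obtain ⟨s₂, rfl⟩ := (hpos' _).1 ha₂
    obtain ⟨t₁, rfl⟩ := (hpos' _).1 hb₁
    obtain ⟨t₂, rfl⟩ := (hpos' _).1 hb₂
    simp only [← map_add, hφq] at h
    obtain ⟨c₁₁, c₁₂, c₂₁, c₂₂, h₁, h₂, h₃, h₄⟩ := h.exists_refinement
    refine ⟨φ (q c₁₁), φ (q c₁₂), φ (q c₂₁), φ (q c₂₂), h_nonneg _, h_nonneg _, h_nonneg _,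
      h_nonneg _, ?_⟩
    simp only [← map_add, hφq]
    exact ⟨h₁, h₂, h₃, h₄⟩
  · intro a b h
    exact (h_single a b).1 ((hφq _ _).1 h)
  · intro k
    constructor
    · rintro ⟨a, rfl⟩
      refine ⟨h_nonneg _, ?_⟩
      rw [← h_isSum.1 (isSum_compl a)]
      exact le_add_of_nonneg_right (h_nonneg _)
    · rintro ⟨h₀, h₁⟩
      obtain ⟨s, rfl⟩ := (hpos' _).1 h₀
      -- Here s + t is equivalent to the letter 1, so its sum is defined; then so is the sum of s,
      -- which is the required element.
      obtain ⟨t, ht⟩ := (hpos' _).1 (sub_nonneg.2 h₁)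
      rw [eq_sub_iff_add_eq', ← map_add, ← map_add, h_sum, wordSum_add, add_eq_of_iff] at ht
      obtain ⟨a, -, ha, -⟩ := ht
      exact ⟨a, (h_sum.2 ha).symm⟩

/-! ### Transfer between an effect algebra and its representing po-group -/

namespace IsGammaRep

variable {E K : Type*} [EffectAlgebra E] [AddCommGroup K] [PartialOrder K] {f : E → K} {u : K}

theorem map_nonneg (hf : IsGammaRep f u) (a : E) : 0 ≤ f a := (hf.exists_iff.1 ⟨a, rfl⟩).1

theorem map_le (hf : IsGammaRep f u) (a : E) : f a ≤ u := (hf.exists_iff.1 ⟨a, rfl⟩).2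

theorem map_zero (hf : IsGammaRep f u) : f 0 = 0 := by
  simpa using hf.isSum_iff.1 (isSum_zero (0 : E))

theorem map_eq_zero_iff (hf : IsGammaRep f u) {a : E} : f a = 0 ↔ a = 0 := by
  rw [← hf.map_zero, hf.injective.eq_iff]

theorem map_compl (hf : IsGammaRep f u) (a : E) : f (compl a) = u - f a := by
  rw [eq_sub_iff_add_eq', hf.isSum_iff.1 (isSum_compl a), hf.map_one]

theorem exists_of_nonneg_of_le (hf : IsGammaRep f u) {k : K} {a : E} (h₀ : 0 ≤ k) (h : k ≤ f a) :
    ∃ b, f b = k := hf.exists_iff.2 ⟨h₀, h.trans (hf.map_le a)⟩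

variable [IsOrderedAddMonoid K]

theorem le_iff (hf : IsGammaRep f u) {a b : E} : Le a b ↔ f a ≤ f b := by
  constructor
  · rintro ⟨c, hc⟩
    rw [← hf.isSum_iff.1 hc]
    exact le_add_of_nonneg_right (hf.map_nonneg c)
  · intro h
    obtain ⟨c, hc⟩ := hf.exists_iff.2
      ⟨sub_nonneg.2 h, (sub_le_self _ (hf.map_nonneg a)).trans (hf.map_le b)⟩
    exact ⟨c, hf.isSum_iff.2 (by rw [hc]; abel)⟩

theorem lt_iff (hf : IsGammaRep f u) {a b : E} : Lt a b ↔ f a < f b := by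
  rw [Lt, hf.le_iff, lt_iff_le_and_ne, Ne, Ne, hf.injective.eq_iff]

theorem isomorphic (hf : IsGammaRep f u) (hu : 0 ≤ u) : Isomorphic E (Gamma K u hu) := by
  choose! g hg using fun k (hk : 0 ≤ k ∧ k ≤ u) => hf.exists_iff.2 hk
  refine ⟨⟨fun a => ⟨f a, hf.map_nonneg a, hf.map_le a⟩, Subtype.ext hf.map_one, hf.isSum_iff.1⟩,
    ⟨fun k => g k.1, hf.injective ?_, fun {a b c} h => ?_⟩, fun a => ?_, fun k => ?_⟩
  · rw [hf.map_one]
    exact hg u ⟨hu, le_rfl⟩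
  · rw [hf.isSum_iff, hg _ a.2, hg _ b.2, hg _ c.2]
    exact h
  · exact hf.injective (hg _ ⟨hf.map_nonneg a, hf.map_le a⟩)
  · exact Subtype.ext (hg _ k.2)

theorem exists_of_isomorphic {hu : 0 ≤ u} (h : Isomorphic E (Gamma K u hu)) :
    ∃ f : E → K, IsGammaRep f u := by
  obtain ⟨f, g, hgf, hfg⟩ := h
  refine ⟨fun a => (f.toFun a).1, fun a b hab => hgf.injective (Subtype.ext hab),
    fun {a b c} => ⟨fun h => f.map_isSum h, fun h => ?_⟩, fun {k} => ⟨?_, fun hk => ?_⟩,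
    congrArg Subtype.val f.map_one⟩
  · have := g.map_isSum (a := f.toFun a) (b := f.toFun b) (c := f.toFun c) h
    rwa [hgf, hgf, hgf] at this
  · rintro ⟨a, rfl⟩
    exact (f.toFun a).2
  · exact ⟨g.toFun ⟨k, hk⟩, congrArg Subtype.val (hfg ⟨k, hk⟩)⟩

theorem rdp (hf : IsGammaRep f u) (hK : GroupRDP K) : RDP E := by
  refine ⟨fun {a₁ a₂ b₁ b₂ s} ha hb => ?_⟩
  rw [hf.isSum_iff] at ha hb
  obtain ⟨c₁₁, c₁₂, c₂₁, c₂₂, h₁₁, h₁₂, h₂₁, h₂₂, e₁, e₂, e₃, e₄⟩ :=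
    hK _ _ _ _ (hf.map_nonneg a₁) (hf.map_nonneg a₂) (hf.map_nonneg b₁) (hf.map_nonneg b₂)
      (ha.trans hb.symm)
  obtain ⟨d₁₁, rfl⟩ := hf.exists_of_nonneg_of_le h₁₁ (e₁ ▸ le_add_of_nonneg_right h₁₂)
  obtain ⟨d₁₂, rfl⟩ := hf.exists_of_nonneg_of_le h₁₂ (e₁ ▸ le_add_of_nonneg_left h₁₁)
  obtain ⟨d₂₁, rfl⟩ := hf.exists_of_nonneg_of_le h₂₁ (e₂ ▸ le_add_of_nonneg_right h₂₂)
  obtain ⟨d₂₂, rfl⟩ := hf.exists_of_nonneg_of_le h₂₂ (e₂ ▸ le_add_of_nonneg_left h₂₁)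
  exact ⟨d₁₁, d₁₂, d₂₁, d₂₂, hf.isSum_iff.2 e₁.symm, hf.isSum_iff.2 e₂.symm,
    hf.isSum_iff.2 e₃.symm, hf.isSum_iff.2 e₄.symm⟩

/-- For p ≤ (n + 1)u, refine p + ((n + 1)u - p) = u + nu. Either the common part of p and u is
nonzero and lies in the interval, or p ≤ nu and n decreases. -/
theorem exists_ne_zero_le (hf : IsGammaRep f u) (hu : IsStrongUnit u) (hK : GroupRDP K) {p : K}
    (h₀ : 0 < p) : ∃ x : E, x ≠ 0 ∧ f x ≤ p := by
  obtain ⟨n, hn⟩ := hu.exists_le_nsmul p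
  induction n generalizing p with
  | zero => exact absurd (h₀.trans_le hn) (by simp)
  | succ n ih =>
    obtain ⟨c₁₁, c₁₂, c₂₁, c₂₂, h₁₁, h₁₂, h₂₁, h₂₂, e₁, -, e₃, e₄⟩ :=
      hK p ((n + 1) • u - p) u (n • u) h₀.le (sub_nonneg.2 hn) hu.nonneg
        (nsmul_nonneg hu.nonneg n) (by rw [add_smul, one_smul]; abel)
    rcases h₁₁.eq_or_lt with h | h
    · rw [← h, zero_add] at e₁
      subst e₁
      exact ih h₀ (e₄ ▸ le_add_of_nonneg_right h₂₂)
    · obtain ⟨x, rfl⟩ := hf.exists_iff.2 ⟨h₁₁, e₃ ▸ le_add_of_nonneg_right h₂₁⟩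
      refine ⟨x, fun hx => h.ne' (hf.map_eq_zero_iff.2 hx), e₁ ▸ le_add_of_nonneg_right h₁₂⟩

/-- If c is the infimum of a and b, then a - c and b - c are disjoint. Were both nonzero, they would
dominate nonzero disjoint elements of the interval. Suprema are treated with c - a and c - b. -/
theorem isAntilattice (hf : IsGammaRep f u) (hu : IsStrongUnit u) (hK : GroupRDP K)
    (h : ∀ x y : E, (∀ z, Le z x → Le z y → z = 0) → x = 0 ∨ y = 0) : IsAntilattice K := by
  have key : ∀ p q : K, 0 ≤ p → 0 ≤ q → (∀ z, z ≤ p → z ≤ q → z ≤ 0) → p = 0 ∨ q = 0 := by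
    intro p q hp hq hpq
    by_contra! hne
    obtain ⟨x, hx, hxp⟩ := hf.exists_ne_zero_le hu hK (hp.lt_of_ne' hne.1)
    obtain ⟨y, hy, hyq⟩ := hf.exists_ne_zero_le hu hK (hq.lt_of_ne' hne.2)
    rcases h x y (fun z hzx hzy => hf.map_eq_zero_iff.1 (le_antisymm
      (hpq _ ((hf.le_iff.1 hzx).trans hxp) ((hf.le_iff.1 hzy).trans hyq)) (hf.map_nonneg z)))
      with h | h
    exacts [hx h, hy h]
  rintro a b (⟨c, hc⟩ | ⟨c, hc⟩)
  · have hca : c ≤ a := hc.1 (by simp)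
    have hcb : c ≤ b := hc.1 (by simp)
    rcases key (a - c) (b - c) (sub_nonneg.2 hca) (sub_nonneg.2 hcb) fun z hza hzb => by
      have : z + c ≤ c := hc.2 (by simpa using ⟨le_sub_iff_add_le.1 hza, le_sub_iff_add_le.1 hzb⟩)
      simpa using this
      with h | h
    · exact .inl (sub_eq_zero.1 h ▸ hcb)
    · exact .inr (sub_eq_zero.1 h ▸ hca)
  · have hca : a ≤ c := hc.1 (by simp)
    have hcb : b ≤ c := hc.1 (by simp)
    rcases key (c - a) (c - b) (sub_nonneg.2 hca) (sub_nonneg.2 hcb) fun z hza hzb => by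
      have : c ≤ c - z := hc.2 (by simpa using ⟨le_sub_comm.1 hza, le_sub_comm.1 hzb⟩)
      simpa using this
      with h | h
    · exact .inr (sub_eq_zero.1 h ▸ hcb)
    · exact .inl (sub_eq_zero.1 h ▸ hca)

end IsGammaRep

theorem EffectAlgebra.Hom.map_zero {E F : Type*} [EffectAlgebra E] [EffectAlgebra F] (f : Hom E F) :
    f.toFun 0 = 0 :=
  cancel (f.map_isSum (isSum_zero 0)) (isSum_zero _)

theorem Prod.Lex.nonneg_iff {H G : Type*} [AddCommGroup H] [PartialOrder H] [AddCommGroup G]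
    [PartialOrder G] {p : H ×ₗ G} :
    0 ≤ p ↔ 0 < (ofLex p).1 ∨ (ofLex p).1 = 0 ∧ 0 ≤ (ofLex p).2 := by
  rw [Prod.Lex.le_iff, @eq_comm _ (ofLex p).1]
  rfl

theorem isDirectedOrder_of_exists_sub {G : Type*} [AddCommGroup G] [PartialOrder G]
    [IsOrderedAddMonoid G] (h : ∀ g : G, ∃ a b, 0 ≤ a ∧ 0 ≤ b ∧ g = a - b) :
    IsDirectedOrder G ∧ IsCodirectedOrder G := by
  constructor <;> refine ⟨fun x y => ?_⟩ <;> obtain ⟨a, b, ha, hb, rfl⟩ := h x <;>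
    obtain ⟨c, d, hc, hd, rfl⟩ := h y
  · exact ⟨a + c, (sub_le_self a hb).trans (le_add_of_nonneg_right hc),
      (sub_le_self c hd).trans (le_add_of_nonneg_left ha)⟩
  · refine ⟨-(b + d), ?_, ?_⟩
    · rw [neg_le_sub_iff_le_add]
      exact (le_add_of_nonneg_right hd).trans (le_add_of_nonneg_left ha)
    · rw [neg_le_sub_iff_le_add]
      exact (le_add_of_nonneg_left hb).trans (le_add_of_nonneg_left hc)

/-! ### Ideals: generated subalgebra, quotient, primeness and strictness -/

namespace EffectIdeal

section

variable {E : Type*} [EffectAlgebra E] (I : EffectIdeal E)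

theorem one_notMem (h : I.carrier ≠ Set.univ) : (1 : E) ∉ I.carrier := fun h1 =>
  h (Set.eq_univ_of_forall fun a => I.mem_of_le ⟨_, isSum_compl a⟩ h1)

theorem compl_notMem (h : I.carrier ≠ Set.univ) {a : E} (ha : a ∈ I.carrier) :
    compl a ∉ I.carrier := fun h' => I.one_notMem h (I.sum_mem ha h' (isSum_compl a))

/-- The effect subalgebra generated by an ideal consists of the ideal and of the complements
of its elements. -/
theorem mem_closure_iff {x : E} :
    x ∈ (Subalgebra.closure I.carrier).carrier ↔ x ∈ I.carrier ∨ compl x ∈ I.carrier := by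
  constructor
  · intro hx
    have hcl : ∀ {a b c : E}, compl a ∈ I.carrier → IsSum a b c → compl c ∈ I.carrier := by
      intro a b c ha hab
      obtain ⟨d, hd, hd'⟩ := assoc_right hab (isSum_compl c)
      rw [← compl_unique hd'] at ha
      exact I.mem_of_le (.of_isSum_right hd) ha
    refine hx ⟨{x | x ∈ I.carrier ∨ compl x ∈ I.carrier}, .inr ?_, ?_, ?_⟩ fun a ha => .inl ha
    · rw [compl_one]; exact I.zero_mem
    · rintro a (ha | ha)
      · exact .inr (by rwa [EffectAlgebra.compl_compl])
      · exact .inl ha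
    · rintro a b c (ha | ha) (hb | hb) hab
      · exact .inl (I.sum_mem ha hb hab)
      · exact .inr (hcl hb (isSum_comm hab))
      · exact .inr (hcl ha hab)
      · exact .inr (hcl ha hab)
  · rintro (hx | hx) F hF
    · exact hF hx
    · rw [← EffectAlgebra.compl_compl x]
      exact F.compl_mem (hF hx)

/-- The map (n, g) ↦ nu + ι(g) is injective since no element of I dominates 1. It carries levels 0
and 1 of the interval onto the images of I and of its complements. Only sums have to be compared, so
the map need not be shown monotone. -/
theorem isomorphic_closure (h : I.carrier ≠ Set.univ) {K : Type*} [AddCommGroup K] [PartialOrder K]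
    [IsOrderedAddMonoid K] {f : E → K} {u : K} (hf : IsGammaRep f u) {G : Type*} [AddCommGroup G]
    [PartialOrder G] [IsOrderedAddMonoid G] (ι : G →+ K) (hι : ∀ g, 0 ≤ ι g ↔ 0 ≤ g)
    (hI : ∀ k, (∃ a ∈ I.carrier, f a = k) ↔ ∃ g, 0 ≤ g ∧ ι g = k) :
    Isomorphic (Subalgebra.closure I.carrier).carrier (LexGamma ℤ G 1 zero_le_one) := by
  have hu : 0 ≤ u := (hf.map_nonneg 1).trans (hf.map_le 1)
  let Φ : ℤ ×ₗ G →+ K := AddMonoidHom.mk' (fun p => (ofLex p).1 • u + ι (ofLex p).2) fun p q => by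
    simp only [ofLex_add, Prod.fst_add, Prod.snd_add, add_smul, map_add]
    abel
  have hΦ : ∀ n g, Φ (toLex (n, g)) = n • u + ι g := fun _ _ => rfl
  have hfst : ∀ n : ℤ, ∀ g, 0 < n → n • u + ι g ≠ 0 := by
    intro n g hn hg
    have h1 : n • u = ι (-g) := by rw [map_neg]; exact eq_neg_of_add_eq_zero_left hg
    have h2 : u ≤ n • u := by
      simpa using zsmul_le_zsmul_left hu (show (1 : ℤ) ≤ n by omega)
    obtain ⟨a, ha, hag⟩ := (hI _).2 ⟨-g, (hι _).1 (h1 ▸ hu.trans h2), rfl⟩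
    refine I.one_notMem h (I.mem_of_le (hf.le_iff.2 ?_) ha)
    rw [hf.map_one, hag, ← h1]
    exact h2
  have hinj : Function.Injective Φ := by
    rw [injective_iff_map_eq_zero]
    intro p hp
    have hp' : (ofLex p).1 • u + ι (ofLex p).2 = 0 := hp
    have h0 : (ofLex p).1 = 0 := by
      rcases lt_trichotomy (ofLex p).1 0 with hn | hn | hn
      · refine absurd ?_ (hfst (-(ofLex p).1) (-(ofLex p).2) (by omega))
        rw [map_neg, neg_smul, ← neg_add, hp', neg_zero]
      · exact hn
      · exact absurd hp' (hfst _ _ hn)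
    have h1 : ι (ofLex p).2 = 0 := by simpa [h0] using hp'
    have h2 : (ofLex p).2 = 0 := le_antisymm
      (neg_nonneg.1 ((hι _).1 (by rw [map_neg, h1, neg_zero]))) ((hι _).1 h1.ge)
    exact ofLex_inj.1 (Prod.ext h0 h2)
  have hex : ∀ x : (Subalgebra.closure I.carrier).carrier,
      ∃ p : ℤ ×ₗ G, Φ p = f x.1 ∧ 0 ≤ p ∧ p ≤ toLex (1, 0) := by
    rintro ⟨x, hx⟩
    rcases (I.mem_closure_iff).1 hx with hx | hx
    · obtain ⟨g, hg, hgx⟩ := (hI _).1 ⟨x, hx, rfl⟩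
      refine ⟨toLex (0, g), by simp [hΦ, hgx], Prod.Lex.nonneg_iff.2 (.inr ⟨rfl, hg⟩),
        Prod.Lex.le_iff.2 (.inl zero_lt_one)⟩
    · obtain ⟨g, hg, hgx⟩ := (hI _).1 ⟨_, hx, rfl⟩
      refine ⟨toLex (1, -g), ?_, Prod.Lex.nonneg_iff.2 (.inl zero_lt_one),
        Prod.Lex.le_iff.2 (.inr ⟨rfl, neg_nonpos.2 hg⟩)⟩
      rw [hΦ, map_neg, hgx, hf.map_compl, one_smul]
      abel
  choose r hr hr₀ hr₁ using hex
  refine IsGammaRep.isomorphic (f := r) (u := toLex (1, 0)) ⟨fun x y hxy => ?_, fun {a b c} => ?_,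
    fun {p} => ⟨?_, fun ⟨h₀, h₁⟩ => ?_⟩, hinj ?hone⟩ _
  case hone =>
    rw [hr, hΦ, map_zero, add_zero, one_smul]
    exact hf.map_one
  · exact Subtype.ext (hf.injective (by rw [← hr, ← hr, hxy]))
  · rw [← hinj.eq_iff, map_add, hr, hr, hr]
    exact hf.isSum_iff
  · rintro ⟨x, rfl⟩
    exact ⟨hr₀ x, hr₁ x⟩
  · suffices ∃ x ∈ (Subalgebra.closure I.carrier).carrier, f x = Φ p by
      obtain ⟨x, hx, hxp⟩ := this
      exact ⟨⟨x, hx⟩, hinj (by rw [hr, hxp])⟩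
    simp only [I.mem_closure_iff]
    rw [Prod.Lex.nonneg_iff] at h₀
    rw [Prod.Lex.le_iff] at h₁
    have hΦp : Φ p = (ofLex p).1 • u + ι (ofLex p).2 := rfl
    rcases h₀ with h₀ | ⟨h₀, hg⟩
    · rcases h₁ with h₁ | ⟨h₁, hg⟩
      -- No integer lies strictly between 0 and 1.
      · simp only [ofLex_toLex] at h₁
        omega
      · simp only [ofLex_toLex] at h₁ hg
        obtain ⟨a, ha, hag⟩ := (hI _).2 ⟨-(ofLex p).2, neg_nonneg.2 hg, rfl⟩
        refine ⟨compl a, .inr (by rwa [EffectAlgebra.compl_compl]), ?_⟩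
        rw [hf.map_compl, hag, hΦp, h₁, map_neg, one_smul, sub_neg_eq_add]
    · obtain ⟨a, ha, hag⟩ := (hI _).2 ⟨_, hg, rfl⟩
      exact ⟨a, .inl ha, by rw [hag, hΦp, h₀, zero_smul, zero_add]⟩

end

section Quotient

variable {E : Type*} [EffectAlgebra E] [RDP E] {I : EffectIdeal E}

theorem isSum_proj {a b c : E} (h : IsSum a b c) : IsSum (I.proj a) (I.proj b) (I.proj c) :=
  ⟨a, b, c, rfl, rfl, rfl, h⟩

theorem proj_zero : I.proj 0 = 0 := rfl

theorem proj_one : I.proj 1 = 1 := rfl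

theorem proj_eq_zero_iff {a : E} : I.proj a = 0 ↔ a ∈ I.carrier := by
  rw [← proj_zero, proj_eq_proj]
  constructor
  · rintro ⟨e, he, f, -, m, h, h'⟩
    cases eq_zero_of_isSum_zero h'
    rwa [isSum_unique h (isSum_zero_left e)]
  · exact fun ha => (Rel.of_sum ha (isSum_zero_left a)).symm

theorem proj_compl_of_mem {a : E} (ha : a ∈ I.carrier) : I.proj (compl a) = 1 :=
  proj_eq_proj.2 (.of_sum ha (isSum_comm (isSum_compl a)))

/-- Lets two sums with congruent values be replaced, without changing the classes of the summands,
by two sums with one and the same value m, to which RDP of E applies. -/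
theorem exists_proj_eq_of_rel {a b m e s : E} (hab : IsSum a b s) (he : e ∈ I.carrier)
    (hm : IsSum m e s) : ∃ p q, I.proj p = I.proj a ∧ I.proj q = I.proj b ∧ IsSum p q m := by
  obtain ⟨a₁, a₂, b₁, b₂, ha, hb, hab, hab'⟩ := RDP.refine_sum hab hm
  exact ⟨a₁, b₁, proj_eq_proj.2 (.of_sum (I.mem_of_le ⟨_, hab'⟩ he) ha),
    proj_eq_proj.2 (.of_sum (I.mem_of_le (.of_isSum_right hab') he) hb), hab⟩

theorem rdp_quot (I : EffectIdeal E) : RDP I.Quot := by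
  refine ⟨?_⟩
  rintro x₁ x₂ y₁ y₂ s ⟨a₁, a₂, s₁, rfl, rfl, rfl, ha⟩ ⟨b₁, b₂, s₂, rfl, rfl, hs, hb⟩
  obtain ⟨e, he, f, hf, m, hm, hm'⟩ := proj_eq_proj.1 hs.symm
  obtain ⟨p₁, p₂, hp₁, hp₂, hp⟩ := exists_proj_eq_of_rel ha he hm
  obtain ⟨q₁, q₂, hq₁, hq₂, hq⟩ := exists_proj_eq_of_rel hb hf hm'
  obtain ⟨c₁₁, c₁₂, c₂₁, c₂₂, h₁, h₂, h₃, h₄⟩ := RDP.refine_sum hp hq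
  refine ⟨I.proj c₁₁, I.proj c₁₂, I.proj c₂₁, I.proj c₂₂, ?_⟩
  rw [← hp₁, ← hp₂, ← hq₁, ← hq₂]
  exact ⟨isSum_proj h₁, isSum_proj h₂, isSum_proj h₃, isSum_proj h₄⟩

theorem le_proj {a b : E} (h : Le a b) : Le (I.proj a) (I.proj b) := by
  obtain ⟨c, hc⟩ := h
  exact ⟨_, isSum_proj hc⟩

theorem Le.zero_left {F : Type*} [EffectAlgebra F] (x : F) : Le 0 x := ⟨x, isSum_zero_left x⟩

theorem Le.trans {F : Type*} [EffectAlgebra F] {x y z : F} : Le x y → Le y z → Le x z := by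
  rintro ⟨a, ha⟩ ⟨b, hb⟩
  obtain ⟨c, -, hc⟩ := assoc_right ha hb
  exact ⟨c, hc⟩

/-- The elements disjoint from `y` modulo the ideal `I`. -/
def disjointFrom (I : EffectIdeal E) (y : E) : EffectIdeal E where
  carrier := {z | ∀ w, Le w z → Le w y → w ∈ I.carrier}
  nonempty := ⟨0, fun w hw _ => I.mem_of_le hw I.zero_mem⟩
  mem_of_le h hb w hw hy := hb w (Le.trans hw h) hy
  sum_mem := by
    rintro a b c ha hb hab w ⟨w', hw⟩ hy
    obtain ⟨c₁, c₂, c₃, c₄, h₁, h₂, h₃, h₄⟩ := RDP.refine_sum hw hab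
    exact I.sum_mem (ha c₁ ⟨_, h₃⟩ (Le.trans ⟨_, h₁⟩ hy))
      (hb c₂ ⟨_, h₄⟩ (Le.trans (.of_isSum_right h₁) hy)) h₁

/-- The elements of principal ideals need no description: minimality, applied to `disjointFrom` at y
and then at z, forces z into I. -/
theorem IsPrime.mem_or_mem (hI : I.IsPrime) {x y : E}
    (h : ∀ z, Le z x → Le z y → z ∈ I.carrier) : x ∈ I.carrier ∨ y ∈ I.carrier := by
  refine hI x y fun z ⟨hzx, hzy⟩ => ?_
  have h₁ : z ∈ (I.disjointFrom y).carrier := hzx _ h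
  have h₂ : z ∈ (I.disjointFrom z).carrier := hzy _ fun w hwy hwz => h₁ w hwz hwy
  exact h₂ z ⟨0, isSum_zero z⟩ ⟨0, isSum_zero z⟩

theorem IsPrime.quot_eq_zero_or (hI : I.IsPrime) {x y : I.Quot}
    (h : ∀ z, Le z x → Le z y → z = 0) : x = 0 ∨ y = 0 := by
  obtain ⟨a, rfl⟩ := I.proj_surjective x
  obtain ⟨b, rfl⟩ := I.proj_surjective y
  rw [proj_eq_zero_iff, proj_eq_zero_iff]
  exact hI.mem_or_mem fun z hza hzb => proj_eq_zero_iff.1 (h _ (le_proj hza) (le_proj hzb))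

/-- Modulo I, a becomes 0 and the complement of b becomes 1, so strictness puts a below that
complement. -/
theorem IsStrict.exists_isSum (hI : I.IsStrict) (h : I.carrier ≠ Set.univ) {a b : E}
    (ha : a ∈ I.carrier) (hb : b ∈ I.carrier) : ∃ c ∈ I.carrier, IsSum a b c := by
  obtain ⟨⟨d, hd⟩, -⟩ := hI a (compl b) (by
    rw [proj_eq_zero_iff.2 ha]
    exact ⟨Le.zero_left _, fun h0 => I.compl_notMem h hb (proj_eq_zero_iff.1 h0.symm)⟩)
  obtain ⟨e, he, -⟩ := assoc_right (isSum_comm hd) (isSum_comm (isSum_compl b))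
  exact ⟨e, I.sum_mem ha hb he, he⟩

end Quotient

end EffectIdeal

/-! ### From a lexicographic ideal to a lexicographic product -/

namespace EffectIdeal

variable {E : Type v} [EffectAlgebra E] [RDP E] {I : EffectIdeal E}

/-- The differences of elements of a strict proper ideal form a subgroup of any po-group that
represents the effect algebra. -/
def differences (hs : I.IsStrict) (hI : I.carrier ≠ Set.univ) {K : Type*} [AddCommGroup K]
    [PartialOrder K] {f : E → K} {v : K} (hf : IsGammaRep f v) : AddSubgroup K where
  carrier := {k | ∃ a ∈ I.carrier, ∃ b ∈ I.carrier, k = f a - f b}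
  zero_mem' := ⟨0, I.zero_mem, 0, I.zero_mem, by simp⟩
  add_mem' := by
    rintro _ _ ⟨a, ha, b, hb, rfl⟩ ⟨c, hc, d, hd, rfl⟩
    obtain ⟨p, hp, hp'⟩ := hs.exists_isSum hI ha hc
    obtain ⟨q, hq, hq'⟩ := hs.exists_isSum hI hb hd
    refine ⟨p, hp, q, hq, ?_⟩
    rw [← hf.isSum_iff.1 hp', ← hf.isSum_iff.1 hq']
    abel
  neg_mem' := by
    rintro _ ⟨a, ha, b, hb, rfl⟩
    exact ⟨b, hb, a, ha, by abel⟩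

theorem IsLexicographic.exists_representation (hI : I.IsLexicographic) :
    ∃ (H : Type v) (_ : AddCommGroup H) (_ : PartialOrder H) (_ : IsOrderedAddMonoid H)
      (u : H) (hu : IsStrongUnit u)
      (G : Type v) (_ : AddCommGroup G) (_ : PartialOrder G) (_ : IsOrderedAddMonoid G),
      Nontrivial H ∧ IsAntilattice H ∧ GroupRDP H ∧
      Isomorphic I.Quot (Gamma H u hu.nonneg) ∧
      Nontrivial G ∧ IsDirectedOrder G ∧ IsCodirectedOrder G ∧ GroupRDP G ∧
      Isomorphic (Subalgebra.closure I.carrier).carrier (LexGamma ℤ G 1 zero_le_one) ∧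
      Isomorphic E (LexGamma H G u hu.nonneg) := by
  obtain ⟨h_zero, h_univ, hs, ⟨δ, hδ⟩, hp⟩ := hI
  have := I.rdp_quot
  obtain ⟨K, _, _, _, v, ψ, -, -, hψ⟩ := exists_isGammaRep E
  obtain ⟨H, _, _, _, u, χ, hu, hH, hχ⟩ := exists_isGammaRep I.Quot
  let G : AddSubgroup K := differences hs h_univ hψ
  have h_mem : ∀ a ∈ I.carrier, ψ a ∈ G := fun a ha =>
    ⟨a, ha, 0, I.zero_mem, by rw [hψ.map_zero, sub_zero]⟩
  -- The positive cone of G is exactly ψ(I): a nonnegative ψ(a) - ψ(b) lies below ψ(a).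
  have h_pos : ∀ g : G, 0 ≤ g → ∃ a ∈ I.carrier, ψ a = g := by
    rintro ⟨_, a, ha, b, hb, rfl⟩ h
    have hle : ψ a - ψ b ≤ ψ a := sub_le_self _ (hψ.map_nonneg b)
    obtain ⟨c, hc⟩ := hψ.exists_of_nonneg_of_le (show 0 ≤ ψ a - ψ b from h) hle
    exact ⟨c, I.mem_of_le (hψ.le_iff.2 (hc ▸ hle)) ha, hc⟩
  have h_diff : ∀ x y, I.proj x = I.proj y → ψ x - ψ y ∈ G := by
    intro x y h
    obtain ⟨e, he, f, hf, m, hm, hm'⟩ := proj_eq_proj.1 h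
    refine ⟨e, he, f, hf, ?_⟩
    rw [← hψ.isSum_iff.1 hm, ← hψ.isSum_iff.1 hm']
    abel
  have h_dir : IsDirectedOrder G ∧ IsCodirectedOrder G := by
    refine isDirectedOrder_of_exists_sub ?_
    rintro ⟨_, a, ha, b, hb, rfl⟩
    exact ⟨⟨ψ a, h_mem a ha⟩, ⟨ψ b, h_mem b hb⟩, hψ.map_nonneg a, hψ.map_nonneg b, rfl⟩
  have h_one : (1 : I.Quot) ≠ 0 := fun h => I.one_notMem h_univ (proj_eq_zero_iff.1 h)
  have hu₀ : u ≠ 0 := by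
    rw [← hχ.map_one, ← hχ.map_zero]
    exact fun h => h_one (hχ.injective h)
  let φ : E → H ×ₗ G := fun x =>
    toLex (χ (I.proj x), ⟨ψ x - ψ (δ.toFun (I.proj x)), h_diff _ _ (hδ _).symm⟩)
  have hφ_eq : ∀ {x : E} {p : H ×ₗ G}, φ x = p ↔ χ (I.proj x) = (ofLex p).1 ∧
      ψ x - ψ (δ.toFun (I.proj x)) = (ofLex p).2 := by
    intro x p
    rw [← ofLex_inj, Prod.ext_iff, Subtype.ext_iff]
    rfl
  have hφ : IsGammaRep φ (toLex (u, 0)) := by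
    refine ⟨fun x y h => ?_, fun {a b c} => ?_, fun {p} => ⟨?_, fun ⟨h₀, h₁⟩ => ?_⟩, ?_⟩
    · obtain ⟨h₁, h₂⟩ := hφ_eq.1 h
      have h₃ : I.proj x = I.proj y := hχ.injective h₁
      rw [h₃] at h₂
      exact hψ.injective (sub_left_injective h₂)
    · rw [eq_comm, hφ_eq, ofLex_add, Prod.fst_add, Prod.snd_add, AddSubgroup.coe_add]
      change _ ↔ χ _ = χ _ + χ _ ∧ ψ c - _ = (ψ a - _) + (ψ b - _)
      rw [eq_comm, ← hχ.isSum_iff]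
      -- Once the classes add up, so do their images under δ, and subtracting these preserves the
      -- equation.
      have hsum : IsSum (I.proj a) (I.proj b) (I.proj c) → (IsSum a b c ↔
          ψ c - ψ (δ.toFun (I.proj c)) = (ψ a - ψ (δ.toFun (I.proj a))) +
            (ψ b - ψ (δ.toFun (I.proj b)))) := by
        intro h
        rw [hψ.isSum_iff, ← hψ.isSum_iff.1 (δ.map_isSum h), sub_add_sub_comm, sub_left_inj,
          eq_comm]
      exact ⟨fun h => ⟨isSum_proj h, (hsum (isSum_proj h)).1 h⟩, fun h => (hsum h.1).2 h.2⟩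
    · rintro ⟨x, rfl⟩
      rw [Prod.Lex.nonneg_iff, Prod.Lex.le_iff]
      change (0 < χ (I.proj x) ∨ χ (I.proj x) = 0 ∧ 0 ≤ ψ x - ψ (δ.toFun (I.proj x))) ∧
        (χ (I.proj x) < u ∨ χ (I.proj x) = u ∧ ψ x - ψ (δ.toFun (I.proj x)) ≤ 0)
      constructor
      · rcases (hχ.map_nonneg (I.proj x)).lt_or_eq with h | h
        · exact .inl h
        · rw [hχ.map_eq_zero_iff.1 h.symm, δ.map_zero, hψ.map_zero, sub_zero]
          exact .inr ⟨hχ.map_zero, hψ.map_nonneg x⟩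
      · rcases (hχ.map_le (I.proj x)).lt_or_eq with h | h
        · exact .inl h
        · refine .inr ⟨h, ?_⟩
          rw [hχ.injective (h.trans hχ.map_one.symm), δ.map_one, hψ.map_one, sub_nonpos]
          exact hψ.map_le x
    · obtain ⟨⟨h, g⟩, rfl⟩ := toLex.surjective p
      have hh₀ : 0 ≤ h := Prod.Lex.monotone_fst _ _ h₀
      have hh₁ : h ≤ u := Prod.Lex.monotone_fst _ _ h₁
      obtain ⟨z, rfl⟩ := hχ.exists_iff.2 ⟨hh₀, hh₁⟩
      suffices ∃ x, I.proj x = z ∧ ψ x = ψ (δ.toFun z) + g by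
        obtain ⟨x, rfl, hx⟩ := this
        exact ⟨x, hφ_eq.2 ⟨rfl, by rw [hx, add_sub_cancel_left]; rfl⟩⟩
      rcases Prod.Lex.nonneg_iff.1 h₀ with h₀ | ⟨h₀, hg⟩
      · rcases Prod.Lex.le_iff.1 h₁ with h₁ | ⟨h₁, hg⟩
        · replace h₀ : Lt 0 z := hχ.lt_iff.2 (hχ.map_zero.symm ▸ h₀)
          replace h₁ : Lt z 1 := hχ.lt_iff.2 (hχ.map_one.symm ▸ h₁)
          -- For 0 < z < 1 and g = ψ(e) - ψ(f), strictness allows f to be subtracted from δ(z) and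
          -- then e to be added, all within the class z.
          obtain ⟨_, e, he, f, hf, rfl⟩ := g
          obtain ⟨⟨m, hm⟩, -⟩ := hs f (δ.toFun z) (by rwa [proj_eq_zero_iff.2 hf, hδ])
          have hmz : I.proj m = z := by
            rw [← hδ z]
            exact proj_eq_proj.2 (.of_sum hf (isSum_comm hm))
          obtain ⟨⟨n, hn⟩, -⟩ := hs m (compl e) (by rwa [proj_compl_of_mem he, hmz])
          obtain ⟨x, hx, -⟩ := assoc_right (isSum_comm hn) (isSum_comm (isSum_compl e))
          refine ⟨x, ?_, ?_⟩
          · rw [← hmz]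
            exact (proj_eq_proj.2 (.of_sum he hx)).symm
          · rw [← hψ.isSum_iff.1 hx, ← hψ.isSum_iff.1 hm]
            change _ = _ + (ψ e - ψ f)
            abel
        · obtain ⟨a, ha, hag⟩ := h_pos (-g) (neg_nonneg.2 hg)
          have hz : z = 1 := hχ.injective (Eq.trans h₁ hχ.map_one.symm)
          refine ⟨compl a, ?_, ?_⟩
          · rw [hz, proj_compl_of_mem ha]
          · rw [hψ.map_compl, hag, hz, δ.map_one, hψ.map_one]
            simp
      · obtain ⟨a, ha, hag⟩ := h_pos g hg
        have hz : z = 0 := hχ.map_eq_zero_iff.1 h₀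
        exact ⟨a, by rw [hz, proj_eq_zero_iff.2 ha],
          by rw [hag, hz, δ.map_zero, hψ.map_zero, zero_add]⟩
    · refine hφ_eq.2 ⟨hχ.map_one, ?_⟩
      rw [proj_one, δ.map_one, sub_self]
      rfl
  refine ⟨H, _, _, ‹_›, u, hu, G, inferInstance, inferInstance, inferInstance, ⟨u, 0, hu₀⟩,
    hχ.isAntilattice hu hH fun x y => hp.quot_eq_zero_or, hH, hχ.isomorphic _, ?_, h_dir.1,
    h_dir.2, ?_, ?_, hφ.isomorphic _⟩
  · obtain ⟨a, ha, ha₀⟩ : ∃ a ∈ I.carrier, a ≠ 0 := by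
      by_contra! h
      exact h_zero (Set.eq_singleton_iff_unique_mem.2 ⟨I.zero_mem, h⟩)
    exact ⟨⟨ψ a, h_mem a ha⟩, 0, fun h => ha₀ (hψ.map_eq_zero_iff.1 (congrArg Subtype.val h))⟩
  · intro a₁ a₂ b₁ b₂ ha₁ ha₂ hb₁ hb₂ h
    obtain ⟨x₁, hx₁, e₁⟩ := h_pos a₁ ha₁
    obtain ⟨x₂, hx₂, e₂⟩ := h_pos a₂ ha₂
    obtain ⟨y₁, hy₁, e₃⟩ := h_pos b₁ hb₁
    obtain ⟨y₂, hy₂, e₄⟩ := h_pos b₂ hb₂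
    -- The equation in G is between sums that are defined in E, so RDP of E refines it.
    obtain ⟨s, -, hsx⟩ := hs.exists_isSum h_univ hx₁ hx₂
    have hsy : IsSum y₁ y₂ s := by
      rw [hψ.isSum_iff, ← hψ.isSum_iff.1 hsx, e₁, e₂, e₃, e₄]
      exact (congrArg Subtype.val h).symm
    obtain ⟨c₁₁, c₁₂, c₂₁, c₂₂, h₁, h₂, h₃, h₄⟩ := RDP.refine_sum hsx hsy
    refine ⟨⟨ψ c₁₁, h_mem _ (I.mem_of_le ⟨_, h₁⟩ hx₁)⟩,
      ⟨ψ c₁₂, h_mem _ (I.mem_of_le (.of_isSum_right h₁) hx₁)⟩,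
      ⟨ψ c₂₁, h_mem _ (I.mem_of_le ⟨_, h₂⟩ hx₂)⟩,
      ⟨ψ c₂₂, h_mem _ (I.mem_of_le (.of_isSum_right h₂) hx₂)⟩, hψ.map_nonneg _, hψ.map_nonneg _,
      hψ.map_nonneg _, hψ.map_nonneg _, ?_, ?_, ?_, ?_⟩
    · exact Subtype.ext (e₁.symm.trans (hψ.isSum_iff.1 h₁).symm)
    · exact Subtype.ext (e₂.symm.trans (hψ.isSum_iff.1 h₂).symm)
    · exact Subtype.ext (e₃.symm.trans (hψ.isSum_iff.1 h₃).symm)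
    · exact Subtype.ext (e₄.symm.trans (hψ.isSum_iff.1 h₄).symm)
  · refine I.isomorphic_closure h_univ hψ G.subtype (fun g => Iff.rfl) fun k => ⟨?_, ?_⟩
    · rintro ⟨a, ha, rfl⟩
      exact ⟨⟨ψ a, h_mem a ha⟩, hψ.map_nonneg a, rfl⟩
    · rintro ⟨g, hg, rfl⟩
      exact h_pos g hg

end EffectIdeal

/-! ### From a lexicographic product to a lexicographic ideal -/

/-- The Riesz interpolation property, in the form that solves a refinement problem. -/
theorem GroupRDP.exists_between {G : Type*} [AddCommGroup G] [PartialOrder G] [IsOrderedAddMonoid G]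
    (hG : GroupRDP G) {a b c d : G} (hac : a ≤ c) (had : a ≤ d) (hbc : b ≤ c) (hbd : b ≤ d) :
    ∃ x, a ≤ x ∧ b ≤ x ∧ x ≤ c ∧ x ≤ d := by
  -- The common part p of c - a and d - a gives the interpolant a + p, which equals b + s.
  obtain ⟨p, q, r, s, hp, hq, hr, hs, e₁, e₂, e₃, e₄⟩ := hG (c - a) (d - b) (d - a) (c - b)
    (sub_nonneg.2 hac) (sub_nonneg.2 hbd) (sub_nonneg.2 had) (sub_nonneg.2 hbc) (by abel)
  refine ⟨a + p, le_add_of_nonneg_right hp, ?_, ?_, ?_⟩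
  · rw [sub_eq_iff_eq_add'] at e₁ e₄
    have : a + p = b + s := by
      rw [e₁, ← add_assoc, add_comm q s, ← add_assoc, add_left_inj] at e₄
      exact e₄
    rw [this]
    exact le_add_of_nonneg_right hs
  · rw [sub_eq_iff_eq_add'.1 e₁]
    exact add_le_add_right (le_add_of_nonneg_right hq) _
  · rw [sub_eq_iff_eq_add'.1 e₃]
    exact add_le_add_right (le_add_of_nonneg_right hr) _

section Lex

variable {H G : Type*} [AddCommGroup H] [PartialOrder H] [AddCommGroup G] [PartialOrder G]
  {E : Type*} [EffectAlgebra E] {u : H} {f : E → H ×ₗ G}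

namespace IsGammaRep

theorem fst_nonneg (hf : IsGammaRep f (toLex (u, 0))) (x : E) : 0 ≤ (ofLex (f x)).1 :=
  Prod.Lex.monotone_fst _ _ (hf.map_nonneg x)

theorem fst_le (hf : IsGammaRep f (toLex (u, 0))) (x : E) : (ofLex (f x)).1 ≤ u :=
  Prod.Lex.monotone_fst _ _ (hf.map_le x)

theorem fst_one (hf : IsGammaRep f (toLex (u, 0))) : (ofLex (f 1)).1 = u := by
  rw [hf.map_one]
  rfl

theorem fst_add (hf : IsGammaRep f (toLex (u, 0))) {a b c : E} (h : IsSum a b c) :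
    (ofLex (f a)).1 + (ofLex (f b)).1 = (ofLex (f c)).1 := by
  rw [← hf.isSum_iff.1 h]
  rfl

theorem exists_eq_zero_snd (hf : IsGammaRep f (toLex (u, 0))) (hu : 0 < u) {g : G} (hg : 0 ≤ g) :
    ∃ x, f x = toLex (0, g) :=
  hf.exists_iff.2 ⟨Prod.Lex.nonneg_iff.2 (.inr ⟨rfl, hg⟩), Prod.Lex.le_iff.2 (.inl hu)⟩

theorem exists_eq_fst_zero (hf : IsGammaRep f (toLex (u, 0))) {h : H} (h₀ : 0 ≤ h) (h₁ : h ≤ u) :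
    ∃ x, f x = toLex (h, 0) := by
  refine hf.exists_iff.2 ⟨toLex_nonneg h₀, Prod.Lex.le_iff.2 ?_⟩
  rcases h₁.lt_or_eq with h | h
  exacts [.inl h, .inr ⟨h, le_rfl⟩]

/-- Because w > 0, any second coordinate is allowed over w; a common lower bound of the two given
ones serves. -/
theorem exists_le_le (hf : IsGammaRep f (toLex (u, 0))) [IsCodirectedOrder G] {x y : E} {w : H}
    (hw : 0 < w) (hx : w ≤ (ofLex (f x)).1) (hy : w ≤ (ofLex (f y)).1) :
    ∃ z, (ofLex (f z)).1 = w ∧ f z ≤ f x ∧ f z ≤ f y := by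
  obtain ⟨n, hnx, hny⟩ := _root_.exists_le_le (ofLex (f x)).2 (ofLex (f y)).2
  have key : ∀ {x : E}, w ≤ (ofLex (f x)).1 → n ≤ (ofLex (f x)).2 → toLex (w, n) ≤ f x :=
    fun hx hn => Prod.Lex.le_iff.2 (hx.lt_or_eq.imp id fun h => ⟨h, hn⟩)
  obtain ⟨z, hz⟩ := hf.exists_of_nonneg_of_le (k := toLex (w, n))
    (Prod.Lex.nonneg_iff.2 (.inl hw)) (key hx hnx)
  exact ⟨z, by rw [hz]; rfl, hz ▸ key hx hnx, hz ▸ key hy hny⟩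

end IsGammaRep

variable [IsOrderedAddMonoid H] [IsOrderedAddMonoid G]

/-- After refinement in H, one second coordinate x determines the other three. Each vanishing cᵢⱼ
imposes one bound on x: lower for c₁₁ and c₂₂, upper for c₁₂ and c₂₁. Positivity of the given
elements makes these bounds compatible. Interpolation solves the case of four bounds, and
directedness the cases with only lower or only upper bounds. -/
theorem GroupRDP.lex (hH : GroupRDP H) (hG : GroupRDP G) [IsDirectedOrder G]
    [IsCodirectedOrder G] : GroupRDP (H ×ₗ G) := by
  have toLex_nonneg_iff : ∀ {h : H} {g : G}, 0 ≤ h → (0 ≤ toLex (h, g) ↔ (h = 0 → 0 ≤ g)) := by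
    intro h g hh
    rw [Prod.Lex.nonneg_iff]
    rcases hh.eq_or_lt with rfl | hh
    · simp
    · simp [hh, hh.ne']
  intro a₁ a₂ b₁ b₂ ha₁ ha₂ hb₁ hb₂ he
  obtain ⟨⟨h₁, g₁⟩, rfl⟩ := toLex.surjective a₁
  obtain ⟨⟨h₂, g₂⟩, rfl⟩ := toLex.surjective a₂
  obtain ⟨⟨k₁, l₁⟩, rfl⟩ := toLex.surjective b₁
  obtain ⟨⟨k₂, l₂⟩, rfl⟩ := toLex.surjective b₂
  rw [← toLex_add, ← toLex_add, toLex_inj, Prod.mk_add_mk, Prod.mk_add_mk, Prod.mk.injEq] at he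
  obtain ⟨c₁₁, c₁₂, c₂₁, c₂₂, h₁₁, h₁₂, h₂₁, h₂₂, rfl, rfl, rfl, rfl⟩ := hH h₁ h₂ k₁ k₂
    (Prod.Lex.monotone_fst _ _ ha₁) (Prod.Lex.monotone_fst _ _ ha₂)
    (Prod.Lex.monotone_fst _ _ hb₁) (Prod.Lex.monotone_fst _ _ hb₂) he.1
  rw [toLex_nonneg_iff (add_nonneg ‹_› ‹_›), add_eq_zero_iff_of_nonneg ‹_› ‹_›, and_imp]
    at ha₁ ha₂ hb₁ hb₂
  obtain ⟨x, hx₁₁, hx₁₂, hx₂₁, hx₂₂⟩ : ∃ x, (c₁₁ = 0 → 0 ≤ x) ∧ (c₁₂ = 0 → x ≤ g₁) ∧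
      (c₂₁ = 0 → x ≤ l₁) ∧ (c₂₂ = 0 → g₁ - l₂ ≤ x) := by
    have hl : g₁ - l₂ = l₁ - g₂ := by rw [sub_eq_sub_iff_add_eq_add, he.2]
    have hb₂' : c₁₂ = 0 → c₂₂ = 0 → g₁ - l₂ ≤ g₁ := fun h h' => sub_le_self _ (hb₂ h h')
    have ha₂' : c₂₁ = 0 → c₂₂ = 0 → g₁ - l₂ ≤ l₁ := fun h h' => hl ▸ sub_le_self _ (ha₂ h h')
    by_cases z₁₁ : c₁₁ = 0 <;> by_cases z₂₂ : c₂₂ = 0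
    · by_cases z₁₂ : c₁₂ = 0 <;> by_cases z₂₁ : c₂₁ = 0
      · obtain ⟨x, h₁, h₂, h₃, h₄⟩ := hG.exists_between (ha₁ z₁₁ z₁₂) (hb₁ z₁₁ z₂₁)
          (hb₂' z₁₂ z₂₂) (ha₂' z₂₁ z₂₂)
        exact ⟨x, fun _ => h₁, fun _ => h₃, fun _ => h₄, fun _ => h₂⟩
      · exact ⟨g₁, fun _ => ha₁ z₁₁ z₁₂, fun _ => le_rfl, fun h => absurd h z₂₁, hb₂' z₁₂⟩
      · exact ⟨l₁, fun _ => hb₁ z₁₁ z₂₁, fun h => absurd h z₁₂, fun _ => le_rfl, ha₂' z₂₁⟩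
      · obtain ⟨x, hx, hx'⟩ := exists_ge_ge 0 (g₁ - l₂)
        exact ⟨x, fun _ => hx, fun h => absurd h z₁₂, fun h => absurd h z₂₁, fun _ => hx'⟩
    · exact ⟨0, fun _ => le_rfl, ha₁ z₁₁, hb₁ z₁₁, fun h => absurd h z₂₂⟩
    · exact ⟨g₁ - l₂, fun h => absurd h z₁₁, fun h => hb₂' h z₂₂, fun h => ha₂' h z₂₂,
        fun _ => le_rfl⟩
    · obtain ⟨x, hx, hx'⟩ := exists_le_le g₁ l₁
      exact ⟨x, fun h => absurd h z₁₁, fun _ => hx, fun _ => hx', fun h => absurd h z₂₂⟩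
  refine ⟨toLex (c₁₁, x), toLex (c₁₂, g₁ - x), toLex (c₂₁, l₁ - x), toLex (c₂₂, x - (g₁ - l₂)),
    (toLex_nonneg_iff h₁₁).2 hx₁₁, (toLex_nonneg_iff h₁₂).2 fun h => sub_nonneg.2 (hx₁₂ h),
    (toLex_nonneg_iff h₂₁).2 fun h => sub_nonneg.2 (hx₂₁ h),
    (toLex_nonneg_iff h₂₂).2 fun h => sub_nonneg.2 (hx₂₂ h), ?_, ?_, ?_, ?_⟩ <;>
    rw [← toLex_add, toLex_inj, Prod.mk_add_mk, Prod.mk.injEq] <;> refine ⟨rfl, ?_⟩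
  · abel
  · rw [eq_sub_of_add_eq' he.2]
    abel
  · abel
  · abel

/-- The ideal of infinitesimal elements of `Γ(H ×ₗ G, (u, 0))`. -/
def IsGammaRep.lexIdeal (hf : IsGammaRep f (toLex (u, 0))) : EffectIdeal E where
  carrier := {x | (ofLex (f x)).1 = 0}
  nonempty := ⟨0, show (ofLex (f 0)).1 = 0 by rw [hf.map_zero]; rfl⟩
  mem_of_le h hb := le_antisymm ((Prod.Lex.monotone_fst _ _ (hf.le_iff.1 h)).trans hb.le)
    (Prod.Lex.monotone_fst _ _ (hf.map_nonneg _))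
  sum_mem {a b c} ha hb h := by
    change (ofLex (f c)).1 = 0
    rw [← hf.isSum_iff.1 h, ofLex_add, Prod.fst_add, show (ofLex (f a)).1 = 0 from ha,
      show (ofLex (f b)).1 = 0 from hb, add_zero]

/-- Otherwise interpolation between 0, t and h, k shows that 0 is the infimum of h and k; they are
then comparable, and the smaller is a positive lower bound. -/
theorem IsAntilattice.exists_pos_le (hA : IsAntilattice H) (hH : GroupRDP H) {h k : H} (hh : 0 < h)
    (hk : 0 < k) : ∃ w, 0 < w ∧ w ≤ h ∧ w ≤ k := by
  by_contra! hne
  have hglb : IsGLB {h, k} 0 := by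
    refine ⟨by simp [hh.le, hk.le], fun t ht => ?_⟩
    obtain ⟨w, hw₀, hwt, hwh, hwk⟩ := hH.exists_between hh.le hk.le (ht (by simp)) (ht (by simp))
    rcases hw₀.eq_or_lt with rfl | hw
    · exact hwt
    · exact absurd hwk (hne w hw hwh)
  rcases hA h k (.inl ⟨0, hglb⟩) with hhk | hkh
  · exact hne h hh le_rfl hhk
  · exact hne k hk hkh le_rfl

theorem IsStrongUnit.pos [Nontrivial H] (hu : IsStrongUnit u) : 0 < u := by
  refine hu.nonneg.lt_of_ne fun h => ?_
  have hle : ∀ g : H, g ≤ 0 := fun g => by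
    obtain ⟨n, hn⟩ := hu.exists_le_nsmul g
    rwa [← h, smul_zero] at hn
  obtain ⟨g, hg⟩ := exists_ne (0 : H)
  exact hg (le_antisymm (hle g) (neg_nonpos.1 (hle (-g))))

namespace IsGammaRep

theorem mem_lexIdeal (hf : IsGammaRep f (toLex (u, 0))) {x : E} :
    x ∈ hf.lexIdeal.carrier ↔ (ofLex (f x)).1 = 0 := Iff.rfl

theorem lexIdeal_ne_univ (hf : IsGammaRep f (toLex (u, 0))) (hu : 0 < u) :
    hf.lexIdeal.carrier ≠ Set.univ := fun h =>
  hu.ne' (hf.fst_one.symm.trans (h.symm ▸ Set.mem_univ (1 : E) : (1 : E) ∈ hf.lexIdeal.carrier))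

/-- Over a positive first coordinate, downward directedness of G supplies z below x and y with that
same coordinate, so both differences are infinitesimal. Over 0, both elements are infinitesimal
themselves. -/
theorem rel_lexIdeal_iff (hf : IsGammaRep f (toLex (u, 0))) [IsCodirectedOrder G] {x y : E} :
    hf.lexIdeal.Rel x y ↔ (ofLex (f x)).1 = (ofLex (f y)).1 := by
  constructor
  · rintro ⟨a, ha, b, hb, m, hx, hy⟩
    rw [← hf.fst_add hx, ← hf.fst_add hy, hf.mem_lexIdeal.1 ha, hf.mem_lexIdeal.1 hb]
  · intro h
    rcases (hf.fst_nonneg x).eq_or_lt with h₀ | h₀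
    · exact ⟨x, h₀.symm, y, (h₀.trans h).symm, 0, isSum_zero_left x, isSum_zero_left y⟩
    · obtain ⟨z, hz, hzx, hzy⟩ := hf.exists_le_le h₀ le_rfl h.le
      obtain ⟨a, ha⟩ := hf.le_iff.2 hzx
      obtain ⟨b, hb⟩ := hf.le_iff.2 hzy
      refine ⟨a, ?_, b, ?_, z, ha, hb⟩
      · exact hf.mem_lexIdeal.2 (add_eq_left.1 ((hf.fst_add ha).trans hz.symm))
      · exact hf.mem_lexIdeal.2 (add_eq_left.1 ((hf.fst_add hb).trans (h.symm.trans hz.symm)))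

variable [RDP E] [IsCodirectedOrder G]

/-- The quotient by the infinitesimal elements is represented by the first coordinate. -/
theorem quot_lexIdeal (hf : IsGammaRep f (toLex (u, 0))) :
    ∃ χ : hf.lexIdeal.Quot → H, IsGammaRep χ u ∧
      ∀ x, χ (hf.lexIdeal.proj x) = (ofLex (f x)).1 := by
  have hlift : ∀ a b : E, (hf.lexIdeal.setoid).r a b → (ofLex (f a)).1 = (ofLex (f b)).1 :=
    fun a b h => hf.rel_lexIdeal_iff.1 h
  let χ : hf.lexIdeal.Quot → H := Quotient.lift (fun x => (ofLex (f x)).1) hlift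
  have hχ : ∀ x, χ (hf.lexIdeal.proj x) = (ofLex (f x)).1 := fun _ => rfl
  refine ⟨χ, ⟨fun x y h => ?_, fun {x y z} => ⟨?_, fun h => ?_⟩, fun {k} => ⟨?_, ?_⟩, hf.fst_one⟩,
    hχ⟩
  · obtain ⟨a, rfl⟩ := hf.lexIdeal.proj_surjective x
    obtain ⟨b, rfl⟩ := hf.lexIdeal.proj_surjective y
    exact EffectIdeal.proj_eq_proj.2 (hf.rel_lexIdeal_iff.2 h)
  · rintro ⟨a, b, c, rfl, rfl, rfl, h⟩
    exact hf.fst_add h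
  · obtain ⟨a, rfl⟩ := hf.lexIdeal.proj_surjective x
    obtain ⟨b, rfl⟩ := hf.lexIdeal.proj_surjective y
    obtain ⟨c, rfl⟩ := hf.lexIdeal.proj_surjective z
    simp only [hχ] at h
    -- Representatives with second coordinate 0 turn the equation in H into a sum in E.
    obtain ⟨a', ha⟩ := hf.exists_eq_fst_zero (hf.fst_nonneg a) (hf.fst_le a)
    obtain ⟨b', hb⟩ := hf.exists_eq_fst_zero (hf.fst_nonneg b) (hf.fst_le b)
    obtain ⟨c', hc⟩ := hf.exists_eq_fst_zero (hf.fst_nonneg c) (hf.fst_le c)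
    refine ⟨a', b', c', ?_, ?_, ?_, ?_⟩
    · rw [EffectIdeal.proj_eq_proj, hf.rel_lexIdeal_iff, ha, ofLex_toLex]
    · rw [EffectIdeal.proj_eq_proj, hf.rel_lexIdeal_iff, hb, ofLex_toLex]
    · rw [EffectIdeal.proj_eq_proj, hf.rel_lexIdeal_iff, hc, ofLex_toLex]
    · rw [hf.isSum_iff, ha, hb, hc, ← toLex_add, Prod.mk_add_mk, h, add_zero]
  · rintro ⟨x, rfl⟩
    obtain ⟨a, rfl⟩ := hf.lexIdeal.proj_surjective x
    exact ⟨hf.fst_nonneg a, hf.fst_le a⟩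
  · rintro ⟨h₀, h₁⟩
    obtain ⟨x, hx⟩ := hf.exists_eq_fst_zero h₀ h₁
    exact ⟨hf.lexIdeal.proj x, by rw [hχ, hx, ofLex_toLex]⟩

theorem lexIdeal_isLexicographic (hf : IsGammaRep f (toLex (u, 0))) [IsDirectedOrder G]
    [Nontrivial G] (hA : IsAntilattice H) (hH : GroupRDP H) (hu : 0 < u) :
    hf.lexIdeal.IsLexicographic := by
  obtain ⟨χ, hχ, hχf⟩ := hf.quot_lexIdeal
  refine ⟨fun h => ?_, hf.lexIdeal_ne_univ hu, fun x y h => ?_, ?_, fun x y hxy => ?_⟩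
  · obtain ⟨g, hg⟩ := exists_ne (0 : G)
    obtain ⟨p, hp₀, hp⟩ := exists_ge_ge 0 g
    -- If I were {0}, the positive cone of G would be trivial, which directedness allows only for G
    -- = 0.
    have hzero : ∀ p : G, 0 ≤ p → p = 0 := fun p hp => by
      obtain ⟨x, hx⟩ := hf.exists_eq_zero_snd hu hp
      have hx₀ : x ∈ hf.lexIdeal.carrier := by rw [hf.mem_lexIdeal, hx, ofLex_toLex]
      rw [h, Set.mem_singleton_iff] at hx₀
      rw [hx₀, hf.map_zero] at hx
      exact (congrArg (fun q => (ofLex q).2) hx).symm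
    have h₁ : g ≤ 0 := hzero p hp₀ ▸ hp
    exact hg (neg_eq_zero.1 (hzero (-g) (neg_nonneg.2 h₁)))
  · rw [hχ.lt_iff, hχf, hχf] at h
    exact hf.lt_iff.2 (Prod.Lex.lt_iff.2 (.inl h))
  · choose δ hδ using fun x => hf.exists_eq_fst_zero (hχ.map_nonneg x) (hχ.map_le x)
    refine ⟨⟨δ, hf.injective ?_, fun {a b c} h => ?_⟩, fun x => hχ.injective ?_⟩
    · rw [hδ, hχ.map_one, hf.map_one]
    · rw [hf.isSum_iff, hδ, hδ, hδ, ← hχ.isSum_iff.1 h, ← toLex_add, Prod.mk_add_mk, add_zero]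
    · rw [hχf, hδ, ofLex_toLex]
  · by_contra! hne
    rw [hf.mem_lexIdeal, hf.mem_lexIdeal] at hne
    -- A positive w below both first coordinates lifts to a z in both principal ideals but outside
    -- I.
    obtain ⟨w, hw, hwx, hwy⟩ := hA.exists_pos_le hH ((hf.fst_nonneg x).lt_of_ne' hne.1)
      ((hf.fst_nonneg y).lt_of_ne' hne.2)
    obtain ⟨z, hz, hzx, hzy⟩ := hf.exists_le_le hw hwx hwy
    exact hw.ne' (hz.symm.trans (hxy ⟨fun J hJ => J.mem_of_le (hf.le_iff.2 hzx) hJ,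
      fun J hJ => J.mem_of_le (hf.le_iff.2 hzy) hJ⟩))

end IsGammaRep

theorem IsGammaRep.isomorphic_closure_lexIdeal (hf : IsGammaRep f (toLex (u, 0))) (hu : 0 < u) :
    Isomorphic (Subalgebra.closure hf.lexIdeal.carrier).carrier (LexGamma ℤ G 1 zero_le_one) := by
  refine hf.lexIdeal.isomorphic_closure (hf.lexIdeal_ne_univ hu) hf
    (AddMonoidHom.mk' (fun g => toLex (0, g)) fun a b => ?_) (fun g => ?_) fun k => ⟨?_, ?_⟩
  · rw [← toLex_add, Prod.mk_add_mk, add_zero]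
  · rw [Prod.Lex.nonneg_iff]
    simp
  · rintro ⟨a, ha, rfl⟩
    refine ⟨(ofLex (f a)).2, ?_, ?_⟩
    · rcases Prod.Lex.nonneg_iff.1 (hf.map_nonneg a) with h | h
      · exact absurd (hf.mem_lexIdeal.1 ha) h.ne'
      · exact h.2
    · rw [AddMonoidHom.mk'_apply, ← hf.mem_lexIdeal.1 ha, Prod.mk.eta, toLex_ofLex]
  · rintro ⟨g, hg, rfl⟩
    obtain ⟨x, hx⟩ := hf.exists_eq_zero_snd hu hg
    exact ⟨x, hf.mem_lexIdeal.2 (by rw [hx, ofLex_toLex]), hx⟩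

end Lex

theorem theorem6p5 :
    (∀ (E : Type v) [EffectAlgebra E] [EffectAlgebra.RDP E] (I : EffectIdeal E),
      I.IsLexicographic →
      ∃ (H : Type v) (_ : AddCommGroup H) (_ : PartialOrder H) (_ : IsOrderedAddMonoid H)
        (u : H) (hu : IsStrongUnit u)
        (G : Type v) (_ : AddCommGroup G) (_ : PartialOrder G) (_ : IsOrderedAddMonoid G),
        Nontrivial H ∧ IsAntilattice H ∧ GroupRDP H ∧
        EffectAlgebra.Isomorphic I.Quot (Gamma H u hu.nonneg) ∧
        Nontrivial G ∧ IsDirectedOrder G ∧ IsCodirectedOrder G ∧ GroupRDP G ∧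
        EffectAlgebra.Isomorphic (EffectAlgebra.Subalgebra.closure I.carrier).carrier
          (LexGamma ℤ G 1 zero_le_one) ∧
        EffectAlgebra.Isomorphic E (LexGamma H G u hu.nonneg)) ∧
    (∀ (E : Type w₁) [EffectAlgebra E]
      (H : Type w₂) [AddCommGroup H] [PartialOrder H] [IsOrderedAddMonoid H]
      (u : H) (hu : IsStrongUnit u)
      (G : Type w₃) [AddCommGroup G] [PartialOrder G] [IsOrderedAddMonoid G],
      Nontrivial H → IsAntilattice H → GroupRDP H →
      Nontrivial G → IsDirectedOrder G → IsCodirectedOrder G → GroupRDP G →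
      EffectAlgebra.Isomorphic E (LexGamma H G u hu.nonneg) →
      ∃ (_ : EffectAlgebra.RDP E) (I : EffectIdeal E),
        I.IsLexicographic ∧
        EffectAlgebra.Isomorphic I.Quot (Gamma H u hu.nonneg) ∧
        EffectAlgebra.Isomorphic (EffectAlgebra.Subalgebra.closure I.carrier).carrier
          (LexGamma ℤ G 1 zero_le_one)) := by
  refine ⟨fun E _ _ I hI => hI.exists_representation, ?_⟩
  intro E _ H _ _ _ u hu G _ _ _ _ hA hH _ _ _ hG hE
  obtain ⟨f, hf⟩ := IsGammaRep.exists_of_isomorphic hE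
  have : RDP E := hf.rdp (hH.lex hG)
  obtain ⟨χ, hχ, -⟩ := hf.quot_lexIdeal
  exact ⟨this, hf.lexIdeal, hf.lexIdeal_isLexicographic hA hH hu.pos, hχ.isomorphic hu.nonneg,
    hf.isomorphic_closure_lexIdeal hu.pos⟩
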